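/- **Setting.** For each $n$ let $X_n$ and $P_n$ be independent $n\times n$ real symmetric (respectively complex Hermitian) random matrices, all defined on one probability space, such that, for each $n$, the law of $X_n$ or the law of $P_n$ is invariant under conjugation by all orthogonal (respectively unitary) matrices. Let $\lambda_1(M)\ge\cdots\ge\lambda_n(M)$ denote the ordered eigenvalues (with multiplicity) of an $n\times n$ matrix $M$ with real spectrum. Assume that $X_n$ is non-negative definite and that, almost surely, $\frac1n\sum_{j=1}^n\delta_{\lambda_j(X_n)}$ converges weakly to a deterministic compactly supported probability measure $\mu_X\neq\delta_0$ and $\lambda_1(X_n)\to b$, $\lambda_n(X_n)\to a$, where $a$ and $b$ are the infimum and the supremum of the support of $\mu_X$. Let $r\ge1$ and let $\theta_1\ge\cdots\ge\theta_r$ be non-zero real numbers not depending on $n$; for $n\ge r$ the matrix $P_n$ has rank $r$ and its non-zero eigenvalues, counted with multiplicity, are $\theta_1,\dots,\theta_r$. Put $\widetilde X_n=X_n(I_n+P_n)$ (its eigenvalues are real) and $$T_{\mu_X}(z)=\int\frac{t}{z-t}\,\mathrm d\mu_X(t),\qquad z\notin[a,b],$$ and let $T_{\mu_X}(a^-)=\lim_{z\uparrow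 a}T_{\mu_X}(z)$ and $T_{\mu_X}(b^+)=\lim_{z\downarrow b}T_{\mu_X}(z)$, which may be infinite. For a subspace $F$, $\langle x,F\rangle$ denotes the norm of the orthogonal projection of $x$ onto $F$. **Theorem 2.7 (Norm of eigenvector projection, multiplicative).** Let $i_0\in\{1,\dots,r\}$ be such that $1/\theta_{i_0}\in(T_{\mu_X}(a^-),T_{\mu_X}(b^+))$. For $n\ge r$ let $$\widetilde\lambda_{i_0}=\begin{cases}\lambda_{i_0}(\widetilde X_n)&\text{if }\theta_{i_0}>0,\\ \lambda_{n-r+i_0}(\widetilde X_n)&\text{if }\theta_{i_0}<0,\end{cases}$$ and let $\widetilde u$ be a unit-norm eigenvector of $\widetilde X_n$ for the eigenvalue $\widetilde\lambda_{i_0}$. Then there is exactly one real number $\rho=T_{\mu_X}^{-1}(1/\theta_{i_0})\notin[a,b]$ with $T_{\mu_X}(\rho)=1/\theta_{i_0}$, $T_{\mu_X}$ is differentiable at $\rho$, and, as $n\to\infty$, almost surely $\widetilde\lambda_{i_0}\to\rho$ and (a) $\displaystyle |\langle\widetilde u,\ker(\theta_{i_0}I_n-P_n)\rangle|^2\longrightarrow\frac{-1}{\theta_{i_0}^2\,\rho\,T_{\mu_X}'(\rho)+\theta_{i_0}}$;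 (b) $\displaystyle \Big\langle\widetilde u,\ \bigoplus_{\theta\in\{\theta_1,\dots,\theta_r\},\ \theta\ne\theta_{i_0}}\ker(\theta I_n-P_n)\Big\rangle\longrightarrow0$. -/

import Mathlib

open MeasureTheory ProbabilityTheory Filter Topology
open scoped BoundedContinuousFunction ENNReal ComplexOrder

noncomputable section

namespace SpikedModel

/-- Matrices carry the product (entrywise) σ-algebra. -/
instance matrixMeasurableSpace {𝕜 : Type*} [MeasurableSpace 𝕜] {n : ℕ} :
    MeasurableSpace (Matrix (Fin n) (Fin n) 𝕜) :=
  inferInstanceAs (MeasurableSpace (Fin n → Fin n → 𝕜))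

/-- The eigenvalues of a square matrix with real spectrum, counted with algebraic multiplicity and
listed in decreasing order: `orderedEigenvalue A 0 ≥ orderedEigenvalue A 1 ≥ ⋯`, so that
`orderedEigenvalue A k` is the `(k + 1)`-st largest eigenvalue of `A` (for `k < n`).
It is used for Hermitian matrices and for products `X * (1 + P)` with `X` non-negative definite and
`P` Hermitian; the latter have the same characteristic polynomial as the Hermitian matrix
`X^{1/2} * (1 + P) * X^{1/2}`, hence a real spectrum. -/
def orderedEigenvalue {𝕜 : Type*} [RCLike 𝕜] {n : ℕ} (A : Matrix (Fin n) (Fin n) 𝕜) (k : ℕ) : ℝ :=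
  ((A.charpoly.roots.map RCLike.re).sort (· ≥ ·)).getD k 0

/-- On Hermitian matrices this is Mathlib's decreasing list of eigenvalues. -/
theorem orderedEigenvalue_eq {𝕜 : Type*} [RCLike 𝕜] {n : ℕ} {A : Matrix (Fin n) (Fin n) 𝕜}
    (hA : A.IsHermitian) (k : Fin (Fintype.card (Fin n))) :
    orderedEigenvalue A k = hA.eigenvalues₀ k := by
  simp [orderedEigenvalue, hA.sort_roots_charpoly_eq_eigenvalues₀, List.getD_eq_getElem?_getD,
    show (k : ℕ) < n by simpa using k.2]

/-- The empirical eigenvalue distribution `(1 / n) ∑ j, δ_{λ_j(A)}`. -/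
def empiricalMeasure {𝕜 : Type*} [RCLike 𝕜] {n : ℕ} (A : Matrix (Fin n) (Fin n) 𝕜) : Measure ℝ :=
  (n : ℝ≥0∞)⁻¹ • ∑ j : Fin n, Measure.dirac (orderedEigenvalue A j)

/-- Weak convergence of a sequence of finite measures on `ℝ`. -/
def WeaklyConverges (ν : ℕ → Measure ℝ) (μ : Measure ℝ) : Prop :=
  ∀ f : ℝ →ᵇ ℝ, Tendsto (fun n => ∫ t, f t ∂(ν n)) atTop (𝓝 (∫ t, f t ∂μ))

/-- The law of the random matrix `M` is invariant under conjugation by every element of the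
unitary group over `𝕜` (the orthogonal group when `𝕜 = ℝ`). -/
def ConjInvariant {𝕜 : Type*} [RCLike 𝕜] {Ω : Type*} [MeasurableSpace Ω] (Pr : Measure Ω) {n : ℕ}
    (M : Ω → Matrix (Fin n) (Fin n) 𝕜) : Prop :=
  ∀ U ∈ Matrix.unitaryGroup (Fin n) 𝕜,
    Measure.map (fun ω => U * M ω * star U) Pr = Measure.map M Pr

/-- `P` is an `n × n` Hermitian matrix of rank `r` whose non-zero eigenvalues, counted with
multiplicity, are `θ 0, …, θ (r - 1)` (to be used with `r ≤ n` and all `θ i` non-zero). -/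
def HasNonzeroSpectrum {𝕜 : Type*} [RCLike 𝕜] {n r : ℕ} (P : Matrix (Fin n) (Fin n) 𝕜)
    (θ : Fin r → ℝ) : Prop :=
  P.IsHermitian ∧
    P.charpoly = Polynomial.X ^ (n - r) *
      ∏ i : Fin r, (Polynomial.X - Polynomial.C ((θ i : ℝ) : 𝕜))

/-- The `T`-transform `T_μ(z) = ∫ t / (z - t) dμ(t)`, on the real line. -/
def tTransform (μ : Measure ℝ) (z : ℝ) : ℝ := ∫ t, t / (z - t) ∂μ

/-- The limit `T_μ(c⁻)` from the left, which may be infinite. -/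
def tTransformLeft (μ : Measure ℝ) (c : ℝ) : EReal :=
  Function.leftLim (fun z => (tTransform μ z : EReal)) c

/-- The limit `T_μ(c⁺)` from the right, which may be infinite. -/
def tTransformRight (μ : Measure ℝ) (c : ℝ) : EReal :=
  Function.rightLim (fun z => (tTransform μ z : EReal)) c

/-- The subspace `ker (θ I - P)` of the Euclidean space `𝕜ⁿ`. -/
def kerSub {𝕜 : Type*} [RCLike 𝕜] {n : ℕ} (P : Matrix (Fin n) (Fin n) 𝕜) (θ : ℝ) :
    Submodule 𝕜 (EuclideanSpace 𝕜 (Fin n)) :=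
  LinearMap.ker (Matrix.toEuclideanLin (((θ : ℝ) : 𝕜) • (1 : Matrix (Fin n) (Fin n) 𝕜) - P))

/-- `⟨x, F⟩`: the norm of the orthogonal projection of `x` onto the subspace `F`. -/
def projNorm {𝕜 : Type*} [RCLike 𝕜] {n : ℕ} (x : EuclideanSpace 𝕜 (Fin n))
    (F : Submodule 𝕜 (EuclideanSpace 𝕜 (Fin n))) : ℝ :=
  ‖F.starProjection x‖

/-- `x` is a unit-norm eigenvector of `A` for the real eigenvalue `l`. -/
def IsUnitEigenvector {𝕜 : Type*} [RCLike 𝕜] {n : ℕ} (A : Matrix (Fin n) (Fin n) 𝕜) (l : ℝ)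
    (x : EuclideanSpace 𝕜 (Fin n)) : Prop :=
  ‖x‖ = 1 ∧ Matrix.toEuclideanLin A x = ((l : ℝ) : 𝕜) • x

/-- The multiplicative perturbation `X (I + P)`. -/
def perturbed {𝕜 : Type*} [RCLike 𝕜] {n : ℕ} (X P : Matrix (Fin n) (Fin n) 𝕜) :
    Matrix (Fin n) (Fin n) 𝕜 :=
  X * (1 + P)

/-- The eigenvalue attached to the (zero-based) index `i : Fin r` of `θ`: the eigenvalue
of `X (I + P)` with the same rank from the top if `θ i > 0`, and the eigenvalue with the
corresponding rank from the bottom if `θ i < 0`. -/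
def outlierEigenvalue {𝕜 : Type*} [RCLike 𝕜] {n r : ℕ} (X P : Matrix (Fin n) (Fin n) 𝕜)
    (θ : Fin r → ℝ) (i : Fin r) : ℝ :=
  if 0 < θ i then orderedEigenvalue (perturbed X P) i
  else orderedEigenvalue (perturbed X P) (n - r + i)

end SpikedModel

end

/-!
Let `v k` be orthonormal eigenvectors of `P` for the eigenvalues `θ k` and let `R = X (z - X)⁻¹`.

*Isotropic law.* By invariance the eigenbasis of `X` may be rotated against the frame `v` by an
independent Haar-distributed unitary matrix. Stein's method for the exchangeable pairs obtained from
random reflections bounds the fourth moment of `⟪v k, X ^ m (v l)⟫ - δ_kl tr (X ^ m) / n` by a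
multiple of `n⁻²`, so by Borel–Cantelli `⟪v k, f(X) (v l)⟫ → δ_kl ∫ f dμ` almost surely, first for
powers and then for all continuous `f`.

*The outlier.* `X (1 + P)` has the eigenvalues of `X^{1/2} (1 + P) X^{1/2}`. After a substitution by
an inverse square root of `±(z - X)`, Courant–Fischer counts its eigenvalues beyond the level `z`
through the Gram matrix of the vectors `R^{1/2} (v k)`, whose limit is `T_μ(z)` times the identity,
so the outlier of `θ k` crosses `z` exactly when `T_μ(z) θ k` crosses `1`.

*The eigenvector.* From `z u = X (1 + P) u` one gets `u = ∑ θ k ⟪v k, u⟫ R (v k)` with `z` the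
outlier. Pairing with `v m` gives `(1 - T_μ(ρ) θ m) ⟪v m, u⟫ → 0`, which kills all coordinates with
`θ m ≠ θ i₀`. Taking norms gives `1 = lim θ i₀ ^ 2 (∑ |⟪v k, u⟫| ^ 2) ∫ (t / (ρ - t)) ^ 2 dμ(t)`,
summed over `θ k = θ i₀`, where the integral is `-ρ T_μ'(ρ) - T_μ(ρ)`.
-/

noncomputable section

namespace SpikedModel

open scoped InnerProductSpace

section FrameOperators

variable {𝕜 : Type*} [RCLike 𝕜] {E : Type*} [NormedAddCommGroup E] [InnerProductSpace 𝕜 E]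
  {κ ι : Type*} [Fintype κ] [Fintype ι]

/-- The weighted frame operator `∑ k, f k • v k (v k)*`. For an orthonormal family `v` it is the
self-adjoint operator with eigenvectors `v k` and eigenvalues `f k` that vanishes on the orthogonal
complement of the family. -/
def frameOp (v : κ → E) (f : κ → ℝ) : E →ₗ[𝕜] E :=
  ∑ k, (f k : 𝕜) • (InnerProductSpace.rankOne 𝕜 (v k) (v k)).toLinearMap

theorem frameOp_apply (v : κ → E) (f : κ → ℝ) (x : E) :
    frameOp (𝕜 := 𝕜) v f x = ∑ k, ((f k : 𝕜) * ⟪v k, x⟫_𝕜) • v k := by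
  simp [frameOp, smul_smul]

theorem inner_frameOp (v : κ → E) (f : κ → ℝ) (x y : E) :
    ⟪x, frameOp (𝕜 := 𝕜) v f y⟫_𝕜 = ∑ k, (f k : 𝕜) * (⟪x, v k⟫_𝕜 * ⟪v k, y⟫_𝕜) := by
  simp only [frameOp_apply, inner_sum, inner_smul_right]
  exact Finset.sum_congr rfl fun k _ => by ring

theorem inner_frameOp_self (v : κ → E) (f : κ → ℝ) (x : E) :
    ⟪x, frameOp (𝕜 := 𝕜) v f x⟫_𝕜 = ((∑ k, f k * ‖⟪v k, x⟫_𝕜‖ ^ 2 : ℝ) : 𝕜) := by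
  rw [inner_frameOp]
  push_cast
  exact Finset.sum_congr rfl fun k _ => by rw [← inner_conj_symm x (v k), RCLike.conj_mul]

theorem isSymmetric_frameOp (v : κ → E) (f : κ → ℝ) : (frameOp (𝕜 := 𝕜) v f).IsSymmetric := by
  intro x y
  rw [← inner_conj_symm, inner_frameOp, inner_frameOp, map_sum]
  refine Finset.sum_congr rfl fun k _ => ?_
  simp only [map_mul, RCLike.conj_ofReal, inner_conj_symm]
  ring

theorem frameOp_add (v : κ → E) (f g : κ → ℝ) :
    frameOp (𝕜 := 𝕜) v (f + g) = frameOp v f + frameOp v g := by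
  simp [frameOp, add_smul, Finset.sum_add_distrib]

theorem frameOp_smul (v : κ → E) (c : ℝ) (f : κ → ℝ) :
    frameOp (𝕜 := 𝕜) v (c • f) = (c : 𝕜) • frameOp v f := by
  simp [frameOp, Finset.smul_sum, mul_smul]

theorem frameOp_sub (v : κ → E) (f g : κ → ℝ) :
    frameOp (𝕜 := 𝕜) v (f - g) = frameOp v f - frameOp v g := by
  simp [frameOp, sub_smul, Finset.sum_sub_distrib]

theorem inner_left_frameOp {v : κ → E} (hv : Orthonormal 𝕜 v) (f : κ → ℝ) (k : κ) (x : E) :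
    ⟪v k, frameOp (𝕜 := 𝕜) v f x⟫_𝕜 = (f k : 𝕜) * ⟪v k, x⟫_𝕜 := by
  rw [frameOp_apply, hv.inner_right_fintype]

theorem frameOp_frameOp {v : κ → E} (hv : Orthonormal 𝕜 v) (f g : κ → ℝ) (x : E) :
    frameOp (𝕜 := 𝕜) v f (frameOp (𝕜 := 𝕜) v g x) = frameOp (𝕜 := 𝕜) v (f * g) x := by
  rw [frameOp_apply v f, frameOp_apply v (f * g)]
  simp only [inner_left_frameOp hv, Pi.mul_apply, RCLike.ofReal_mul, mul_assoc]

theorem frameOp_one (b : OrthonormalBasis ι 𝕜 E) : frameOp (𝕜 := 𝕜) b 1 = LinearMap.id := by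
  ext x
  simp [frameOp_apply, b.sum_repr' x]

theorem norm_frameOp_sq {v : κ → E} (hv : Orthonormal 𝕜 v) (f : κ → ℝ) (x : E) :
    ‖frameOp (𝕜 := 𝕜) v f x‖ ^ 2 = ∑ k, f k ^ 2 * ‖⟪v k, x⟫_𝕜‖ ^ 2 := by
  have h : ⟪frameOp (𝕜 := 𝕜) v f x, frameOp (𝕜 := 𝕜) v f x⟫_𝕜 =
      ((∑ k, (f * f) k * ‖⟪v k, x⟫_𝕜‖ ^ 2 : ℝ) : 𝕜) := by
    rw [isSymmetric_frameOp, frameOp_frameOp hv, inner_frameOp_self]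
  rw [inner_self_eq_norm_sq_to_K] at h
  simp only [Pi.mul_apply, ← sq] at h
  exact_mod_cast h

theorem norm_frameOp_le {v : κ → E} (hv : Orthonormal 𝕜 v) {f : κ → ℝ} {K : ℝ} (hK : 0 ≤ K)
    (hf : ∀ k, |f k| ≤ K) (x : E) : ‖frameOp (𝕜 := 𝕜) v f x‖ ≤ K * ‖x‖ := by
  refine le_of_sq_le_sq ?_ (by positivity)
  calc ‖frameOp (𝕜 := 𝕜) v f x‖ ^ 2 = ∑ k, f k ^ 2 * ‖⟪v k, x⟫_𝕜‖ ^ 2 := norm_frameOp_sq hv f x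
    _ ≤ ∑ k, K ^ 2 * ‖⟪v k, x⟫_𝕜‖ ^ 2 := by
        refine Finset.sum_le_sum fun k _ => mul_le_mul_of_nonneg_right ?_ (sq_nonneg _)
        exact sq_le_sq.2 ((hf k).trans (le_abs_self K))
    _ ≤ (K * ‖x‖) ^ 2 := by
        rw [← Finset.mul_sum, mul_pow]
        gcongr
        exact hv.sum_inner_products_le x

theorem norm_inner_frameOp_le {v : κ → E} (hv : Orthonormal 𝕜 v) {f : κ → ℝ} {K : ℝ} (hK : 0 ≤ K)
    (hf : ∀ k, |f k| ≤ K) (x y : E) : ‖⟪x, frameOp (𝕜 := 𝕜) v f y⟫_𝕜‖ ≤ K * (‖x‖ * ‖y‖) :=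
  calc ‖⟪x, frameOp (𝕜 := 𝕜) v f y⟫_𝕜‖ ≤ ‖x‖ * ‖frameOp (𝕜 := 𝕜) v f y‖ := norm_inner_le_norm _ _
    _ ≤ ‖x‖ * (K * ‖y‖) := by gcongr; exact norm_frameOp_le hv hK hf y
    _ = K * (‖x‖ * ‖y‖) := by ring

theorem eq_frameOp_of_apply_eq_smul (b : OrthonormalBasis ι 𝕜 E) {A : E →ₗ[𝕜] E} {f : ι → ℝ}
    (h : ∀ i, A (b i) = (f i : 𝕜) • b i) : A = frameOp b f := by
  classical
  refine b.toBasis.ext fun i => ?_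
  simp [frameOp_apply, h, orthonormal_iff_ite.1 b.orthonormal]

end FrameOperators

section CourantFischer

variable {𝕜 : Type*} [RCLike 𝕜] {E : Type*} [NormedAddCommGroup E] [InnerProductSpace 𝕜 E]
  {ι : Type*} [Fintype ι]

theorem le_of_form_ge (e : OrthonormalBasis ι 𝕜 E) (l : ι → ℝ) (s : Finset ι) {c L : ℝ}
    (hl : ∀ i ∉ s, l i ≤ L) (W : Submodule 𝕜 E) (hW : s.card < Module.finrank 𝕜 W)
    (hform : ∀ w ∈ W, c * ‖w‖ ^ 2 ≤ ∑ i, l i * ‖⟪e i, w⟫_𝕜‖ ^ 2) : c ≤ L := by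
  have := Module.Finite.of_basis e.toBasis
  -- A dimension count gives a non-zero `w ∈ W` orthogonal to the eigenvectors indexed by `s`.
  let φ : W →ₗ[𝕜] (s → 𝕜) := LinearMap.pi fun i => (innerₛₗ 𝕜 (e i)).comp W.subtype
  obtain ⟨w, hw, hw0⟩ := Submodule.exists_mem_ne_zero_of_ne_bot
    (LinearMap.ker_ne_bot_of_finrank_lt (f := φ) (by simpa using hW))
  have hws : ∀ i ∈ s, ⟪e i, (w : E)⟫_𝕜 = 0 := fun i hi =>
    congrFun (LinearMap.mem_ker.1 hw) ⟨i, hi⟩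
  have hpos : 0 < ‖(w : E)‖ ^ 2 := by
    have : (w : E) ≠ 0 := by simpa using hw0
    positivity
  refine le_of_mul_le_mul_right ((hform w w.2).trans ?_) hpos
  rw [← e.sum_sq_norm_inner_right (w : E), Finset.mul_sum]
  refine Finset.sum_le_sum fun i _ => ?_
  by_cases hi : i ∈ s
  · simp [hws i hi]
  · gcongr
    exact hl i hi

/-- The elements of `s` are the indices ranked before `i` in some decreasing arrangement of `f`. -/
def IsRankedBefore {α : Type*} (f : α → ℝ) (i : α) (s : Finset α) : Prop :=
  i ∉ s ∧ (∀ k ∈ s, f i ≤ f k) ∧ ∀ k ∉ s, f k ≤ f i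

theorem IsRankedBefore.le_of_form_ge {e : OrthonormalBasis ι 𝕜 E} {l : ι → ℝ} {j : ι}
    {s : Finset ι} (hs : IsRankedBefore l j s) {c : ℝ} (W : Submodule 𝕜 E)
    (hW : s.card < Module.finrank 𝕜 W)
    (hform : ∀ w ∈ W, c * ‖w‖ ^ 2 ≤ ∑ i, l i * ‖⟪e i, w⟫_𝕜‖ ^ 2) : c ≤ l j :=
  SpikedModel.le_of_form_ge e l s hs.2.2 W hW hform

theorem IsRankedBefore.le_of_form_le {e : OrthonormalBasis ι 𝕜 E} {l : ι → ℝ} {j : ι}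
    {s : Finset ι} (hs : IsRankedBefore l j s) {c : ℝ} (W : Submodule 𝕜 E)
    (hW : Module.finrank 𝕜 E ≤ Module.finrank 𝕜 W + s.card)
    (hform : ∀ w ∈ W, ∑ i, l i * ‖⟪e i, w⟫_𝕜‖ ^ 2 ≤ c * ‖w‖ ^ 2) : l j ≤ c := by
  classical
  rw [← neg_le_neg_iff]
  refine SpikedModel.le_of_form_ge e (-l) (insert j s)ᶜ (fun i hi => ?_) W ?_ fun w hw => ?_
  · rcases Finset.mem_insert.1 (Finset.notMem_compl.1 hi) with rfl | hi
    · exact le_rfl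
    · exact neg_le_neg (hs.2.1 i hi)
  · have hcard := Finset.card_add_card_compl (insert j s)
    rw [Finset.card_insert_of_notMem hs.1] at hcard
    rw [Module.finrank_eq_card_basis e.toBasis] at hW
    lia
  · simpa [Finset.sum_neg_distrib] using hform w hw

end CourantFischer

section AlmostOrthogonal

variable {𝕜 : Type*} [RCLike 𝕜] {α : Type*} {L : Filter α} {κ : Type*} [Fintype κ]

/-- The real part of the quadratic form with matrix `M`. -/
def quadForm (M : κ → κ → 𝕜) (c : κ → 𝕜) : ℝ :=
  RCLike.re (∑ k, ∑ l, (starRingEnd 𝕜) (c k) * c l * M k l)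

theorem continuous_quadForm :
    Continuous fun q : (κ → κ → 𝕜) × (κ → 𝕜) => quadForm q.1 q.2 := by
  refine RCLike.continuous_re.comp (continuous_finsetSum _ fun k _ =>
    continuous_finsetSum _ fun l _ => ?_)
  exact ((RCLike.continuous_conj.comp (by fun_prop)).mul (by fun_prop)).mul (by fun_prop)

theorem quadForm_smul (M : κ → κ → 𝕜) (t : ℝ) (c : κ → 𝕜) :
    quadForm M ((t : 𝕜) • c) = t ^ 2 * quadForm M c := by
  simp only [quadForm, ← RCLike.re_ofReal_mul, Finset.mul_sum, Pi.smul_apply, smul_eq_mul, map_mul,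
    RCLike.conj_ofReal]
  refine congrArg RCLike.re (Finset.sum_congr rfl fun k _ => Finset.sum_congr rfl fun l _ => ?_)
  push_cast
  ring

theorem quadForm_diagonal [DecidableEq κ] (d : κ → ℝ) (c : κ → 𝕜) :
    quadForm (fun k l => if k = l then (d k : 𝕜) else 0) c = ∑ k, d k * ‖c k‖ ^ 2 := by
  simp only [quadForm, mul_ite, mul_zero, Finset.sum_ite_eq, Finset.mem_univ, if_true,
    RCLike.conj_mul, map_sum, ← RCLike.ofReal_pow, ← RCLike.ofReal_mul, RCLike.ofReal_re]
  exact Finset.sum_congr rfl fun k _ => mul_comm _ _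

theorem quadForm_sub (M N : κ → κ → 𝕜) (c : κ → 𝕜) :
    quadForm (fun k l => M k l - N k l) c = quadForm M c - quadForm N c := by
  simp only [quadForm, mul_sub, Finset.sum_sub_distrib, map_sub]

theorem quadForm_inner {E : Type*} [NormedAddCommGroup E] [InnerProductSpace 𝕜 E] (g : κ → E)
    (S : E →ₗ[𝕜] E) (c : κ → 𝕜) :
    quadForm (fun k l => ⟪g k, S (g l)⟫_𝕜) c =
      RCLike.re ⟪∑ k, c k • g k, S (∑ k, c k • g k)⟫_𝕜 := by
  simp only [quadForm, map_sum, map_smul, sum_inner, inner_sum, inner_smul_left, inner_smul_right,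
    Finset.mul_sum, mul_assoc]
  rw [Finset.sum_comm]
  exact Finset.sum_congr rfl fun k _ => Finset.sum_congr rfl fun l _ => by rw [mul_left_comm]

theorem eventually_quadForm_pos [DecidableEq κ] {M : α → κ → κ → 𝕜} {d : κ → ℝ}
    (hd : ∀ k, 0 < d k)
    (hM : ∀ k l, Tendsto (fun a => M a k l) L (𝓝 (if k = l then (d k : 𝕜) else 0))) :
    ∀ᶠ a in L, ∀ c : κ → 𝕜, c ≠ 0 → 0 < quadForm (M a) c := by
  have hpos : ∀ c ∈ Metric.sphere (0 : κ → 𝕜) 1,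
      0 < quadForm (fun k l => if k = l then (d k : 𝕜) else 0) c := fun c hc => by
    obtain ⟨m, hm⟩ := Function.ne_iff.1 (ne_zero_of_mem_unit_sphere ⟨c, hc⟩)
    rw [quadForm_diagonal]
    exact Finset.sum_pos' (fun k _ => mul_nonneg (hd k).le (sq_nonneg _))
      ⟨m, Finset.mem_univ m, mul_pos (hd m) (pow_pos (norm_pos_iff.2 hm) 2)⟩
  have hsphere := (isCompact_sphere (0 : κ → 𝕜) 1).eventually_forall_of_forall_eventually
    (P := fun M c => 0 < quadForm M c)
    fun c hc => continuous_quadForm.continuousAt.eventually (lt_mem_nhds (hpos c hc))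
  have hlim : Tendsto M L (𝓝 fun k l => if k = l then (d k : 𝕜) else 0) :=
    tendsto_pi_nhds.2 fun k => tendsto_pi_nhds.2 fun l => hM k l
  filter_upwards [hlim.eventually hsphere] with a ha c hc
  have hunit : ((‖c‖⁻¹ : ℝ) : 𝕜) • c ∈ Metric.sphere (0 : κ → 𝕜) 1 := by
    simp [norm_smul, hc]
  exact pos_of_mul_pos_right (quadForm_smul (M a) _ c ▸ ha _ hunit) (sq_nonneg _)

variable {F : α → Type*} [∀ a, NormedAddCommGroup (F a)] [∀ a, InnerProductSpace 𝕜 (F a)]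
  {g : ∀ a, κ → F a} {τ : ℝ}

/-- The Gram matrix of the family `g a` tends to `τ • 1` along the filter `L`. -/
def GramTendsto [DecidableEq κ] (𝕜 : Type*) [RCLike 𝕜] [∀ a, InnerProductSpace 𝕜 (F a)]
    (g : ∀ a, κ → F a) (L : Filter α) (τ : ℝ) : Prop :=
  ∀ k l, Tendsto (fun a => ⟪g a k, g a l⟫_𝕜) L (𝓝 (if k = l then (τ : 𝕜) else 0))

variable [DecidableEq κ]

theorem GramTendsto.inner_frameOp (hg : GramTendsto 𝕜 g L τ) (p : κ → ℝ) (k l : κ) :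
    Tendsto (fun a => ⟪g a k, frameOp (𝕜 := 𝕜) (g a) p (g a l)⟫_𝕜) L
      (𝓝 (if k = l then ((p k * τ ^ 2 : ℝ) : 𝕜) else 0)) := by
  have h := tendsto_finsetSum Finset.univ fun m _ =>
    ((hg k m).mul (hg m l)).const_mul (p m : 𝕜)
  simp only [SpikedModel.inner_frameOp]
  convert h using 2
  split_ifs with hkl
  · subst hkl
    simp [sq]
  · simp [hkl]

theorem GramTendsto.eventually_exists_submodule (hg : GramTendsto 𝕜 g L τ) (hτ : 0 < τ)
    {p : κ → ℝ} {J : Finset κ} (hp : ∀ k ∈ J, 1 < p k * τ) :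
    ∀ᶠ a in L, ∃ W : Submodule 𝕜 (F a), Module.finrank 𝕜 W = J.card ∧
      ∀ y ∈ W, ‖y‖ ^ 2 ≤ ∑ k, p k * ‖⟪g a k, y⟫_𝕜‖ ^ 2 := by
  -- The form `∑ k, p k ‖⟪g k, y⟫‖² - ‖y‖²` is positive on the span of the vectors `g k`, `k ∈ J`.
  have hS := eventually_quadForm_pos (L := L) (κ := J) (d := fun k => p k * τ ^ 2 - τ)
    (M := fun a k l => ⟪g a k, (frameOp (g a) p - LinearMap.id : F a →ₗ[𝕜] F a) (g a l)⟫_𝕜)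
    (fun k => by nlinarith [hp k k.2]) fun k l => by
      convert (hg.inner_frameOp p k l).sub (hg k l) using 2
      · simp [inner_sub_right]
      · by_cases hkl : k = l
        · simp [hkl]
        · simp [hkl, Subtype.coe_injective.ne hkl]
  filter_upwards [hS] with a ha
  let T : (J → 𝕜) →ₗ[𝕜] F a := Fintype.linearCombination 𝕜 fun k : J => g a k
  have hform : ∀ c, quadForm (fun k l : J =>
      ⟪g a k, (frameOp (g a) p - LinearMap.id : F a →ₗ[𝕜] F a) (g a l)⟫_𝕜) c =
        ∑ k, p k * ‖⟪g a k, T c⟫_𝕜‖ ^ 2 - ‖T c‖ ^ 2 := fun c => by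
    rw [quadForm_inner fun k : J => g a k, LinearMap.sub_apply, LinearMap.id_apply, inner_sub_right,
      inner_frameOp_self, map_sub, RCLike.ofReal_re, inner_self_eq_norm_sq]
    rfl
  have hT : Function.Injective T := (injective_iff_map_eq_zero T).2 fun c hc => by
    by_contra h0
    have h := ha c h0
    rw [hform, hc] at h
    simp at h
  refine ⟨LinearMap.range T, by simp [LinearMap.finrank_range_of_inj hT], ?_⟩
  rintro _ ⟨c, rfl⟩
  rcases eq_or_ne c 0 with rfl | hc
  · simp
  · exact (sub_pos.1 (hform c ▸ ha c hc)).le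

theorem GramTendsto.eventually_sum_sq_norm_inner_le (hg : GramTendsto 𝕜 g L τ) {σ : ℝ}
    (hσ₀ : 0 ≤ σ) (hσ : τ < σ) :
    ∀ᶠ a in L, ∀ y, ∑ k, ‖⟪g a k, y⟫_𝕜‖ ^ 2 ≤ σ * ‖y‖ ^ 2 := by
  have hS := eventually_quadForm_pos (L := L) (d := fun _ : κ => σ - τ)
    (M := fun a k l => (if k = l then (σ : 𝕜) else 0) - ⟪g a k, g a l⟫_𝕜)
    (fun _ => sub_pos.2 hσ) fun k l => by
      convert (hg k l).const_sub (if k = l then (σ : 𝕜) else 0) using 2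
      split_ifs <;> simp
  filter_upwards [hS] with a ha y
  set c : κ → 𝕜 := fun k => ⟪g a k, y⟫_𝕜
  have hc : ⟪y, ∑ k, c k • g a k⟫_𝕜 = ((∑ k, ‖c k‖ ^ 2 : ℝ) : 𝕜) := by
    simpa [frameOp_apply, c] using inner_frameOp_self (𝕜 := 𝕜) (g a) (fun _ => 1) y
  have hcauchy : ∑ k, ‖c k‖ ^ 2 ≤ ‖y‖ * ‖∑ k, c k • g a k‖ := by
    have h := norm_inner_le_norm (𝕜 := 𝕜) y (∑ k, c k • g a k)
    rwa [hc, RCLike.norm_ofReal, abs_of_nonneg (Finset.sum_nonneg fun k _ => sq_nonneg _)] at h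
  have hgram : ‖∑ k, c k • g a k‖ ^ 2 ≤ σ * ∑ k, ‖c k‖ ^ 2 := by
    rcases eq_or_ne c 0 with h0 | h0
    · simp [h0]
    · have hid := quadForm_inner (g a) LinearMap.id c
      rw [LinearMap.id_apply, inner_self_eq_norm_sq] at hid
      rw [← hid, Finset.mul_sum, ← quadForm_diagonal (fun _ => σ), ← sub_nonneg, ← quadForm_sub]
      exact (ha c h0).le
  have hq : 0 ≤ ∑ k, ‖c k‖ ^ 2 := Finset.sum_nonneg fun k _ => sq_nonneg _
  rcases hq.eq_or_lt with hq | hq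
  · rw [← hq]
    positivity
  · refine le_of_mul_le_mul_right ?_ hq
    calc (∑ k, ‖c k‖ ^ 2) * ∑ k, ‖c k‖ ^ 2 ≤ (‖y‖ * ‖∑ k, c k • g a k‖) ^ 2 := by
          rw [← sq]
          gcongr
      _ = ‖y‖ ^ 2 * ‖∑ k, c k • g a k‖ ^ 2 := mul_pow _ _ _
      _ ≤ ‖y‖ ^ 2 * (σ * ∑ k, ‖c k‖ ^ 2) := by gcongr
      _ = σ * ‖y‖ ^ 2 * ∑ k, ‖c k‖ ^ 2 := by ring

end AlmostOrthogonal

section OrthonormalSpan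

variable {𝕜 : Type*} [RCLike 𝕜] {E : Type*} [NormedAddCommGroup E] [InnerProductSpace 𝕜 E]
  {κ : Type*} {v : κ → E}

theorem norm_sq_sum_smul (hv : Orthonormal 𝕜 v) (s : Finset κ) (c : κ → 𝕜) :
    ‖∑ k ∈ s, c k • v k‖ ^ 2 = ∑ k ∈ s, ‖c k‖ ^ 2 := by
  have h : ⟪∑ k ∈ s, c k • v k, ∑ k ∈ s, c k • v k⟫_𝕜 = ((∑ k ∈ s, ‖c k‖ ^ 2 : ℝ) : 𝕜) := by
    rw [hv.inner_sum]
    push_cast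
    exact Finset.sum_congr rfl fun k _ => RCLike.conj_mul _
  rw [inner_self_eq_norm_sq_to_K] at h
  exact_mod_cast h

theorem norm_starProjection_span_sq (hv : Orthonormal 𝕜 v) (s : Finset κ) (u : E)
    [(Submodule.span 𝕜 (v '' s)).HasOrthogonalProjection] :
    ‖(Submodule.span 𝕜 (v '' s)).starProjection u‖ ^ 2 = ∑ k ∈ s, ‖⟪v k, u⟫_𝕜‖ ^ 2 := by
  have h : (Submodule.span 𝕜 (v '' s)).starProjection u = ∑ k ∈ s, ⟪v k, u⟫_𝕜 • v k := by
    apply Submodule.eq_starProjection_of_mem_of_inner_eq_zero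
    · exact Submodule.sum_mem _ fun k hk => Submodule.smul_mem _ _
        (Submodule.subset_span ⟨k, hk, rfl⟩)
    · intro w hw
      induction hw using Submodule.span_induction with
      | mem w hw =>
        obtain ⟨m, hm, rfl⟩ := hw
        rw [← inner_conj_symm, inner_sub_right, hv.inner_right_sum _ hm, sub_self, map_zero]
      | zero => exact inner_zero_right _
      | add x y _ _ hx hy => rw [inner_add_right, hx, hy, add_zero]
      | smul c x _ hx => rw [inner_smul_right, hx, mul_zero]
  rw [h, norm_sq_sum_smul hv]

theorem frameOp_eq_smul_iff_mem_span [Fintype κ] (hv : Orthonormal 𝕜 v) (θ : κ → ℝ) {t : ℝ}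
    (ht : t ≠ 0) (x : E) :
    frameOp (𝕜 := 𝕜) v θ x = (t : 𝕜) • x ↔
      x ∈ Submodule.span 𝕜 (v '' ({k | θ k = t} : Finset κ)) := by
  classical
  refine ⟨fun hx => ?_, fun hx => ?_⟩
  · have ht' : (t : 𝕜) ≠ 0 := by exact_mod_cast ht
    rw [← inv_smul_smul₀ ht' x, ← hx, frameOp_apply]
    refine Submodule.smul_mem _ _ (Submodule.sum_mem _ fun k _ => ?_)
    by_cases hk : θ k = t
    · exact Submodule.smul_mem _ _ (Submodule.subset_span ⟨k, by simp [hk], rfl⟩)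
    · have h : ((θ k : 𝕜) - t) * ⟪v k, x⟫_𝕜 = 0 := by
        rw [sub_mul, ← inner_left_frameOp hv, hx, inner_smul_right, sub_self]
      have hk' : (θ k : 𝕜) - t ≠ 0 := sub_ne_zero.2 (by exact_mod_cast hk)
      simp [(mul_eq_zero.1 h).resolve_left hk']
  · suffices Submodule.span 𝕜 (v '' ({k | θ k = t} : Finset κ)) ≤
        LinearMap.eqLocus (frameOp v θ) ((t : 𝕜) • LinearMap.id) from this hx
    rw [Submodule.span_le]
    rintro _ ⟨k, hk, rfl⟩
    have hk : θ k = t := by simpa using hk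
    simp [frameOp_apply, orthonormal_iff_ite.1 hv, hk]

end OrthonormalSpan

section MatrixStructure

variable {𝕜 : Type*} [RCLike 𝕜] {n r : ℕ}

theorem toEuclideanLin_mul_apply (A B : Matrix (Fin n) (Fin n) 𝕜) (v : EuclideanSpace 𝕜 (Fin n)) :
    Matrix.toEuclideanLin (A * B) v = Matrix.toEuclideanLin A (Matrix.toEuclideanLin B v) := by
  rw [Matrix.toEuclideanLin, Matrix.toLpLin_mul_same, LinearMap.comp_apply]

theorem toEuclideanLin_one :
    Matrix.toEuclideanLin (1 : Matrix (Fin n) (Fin n) 𝕜) = LinearMap.id :=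
  Matrix.toLpLin_one 2

theorem toEuclideanLin_eigenvectorBasis {A : Matrix (Fin n) (Fin n) 𝕜} (hA : A.IsHermitian)
    (i : Fin n) :
    Matrix.toEuclideanLin A (hA.eigenvectorBasis i) =
      (hA.eigenvalues i : 𝕜) • hA.eigenvectorBasis i := by
  ext k
  simpa [Matrix.toLpLin_apply, RCLike.real_smul_eq_coe_mul] using
    congrFun (hA.mulVec_eigenvectorBasis i) k

theorem orderedEigenvalue_antitone {A : Matrix (Fin n) (Fin n) 𝕜} (hA : A.IsHermitian) :
    Antitone fun i : Fin n => orderedEigenvalue A i := fun i j hij => by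
  have h := hA.eigenvalues₀_antitone (Fin.cast_le_cast (Fintype.card_fin n).symm |>.2 hij)
  simpa only [← orderedEigenvalue_eq hA, Fin.val_cast] using h

theorem exists_equiv_eigenvalues_eq {A : Matrix (Fin n) (Fin n) 𝕜} (hA : A.IsHermitian) :
    ∃ σ : Fin n ≃ Fin n, ∀ i, hA.eigenvalues i = orderedEigenvalue A (σ i) :=
  ⟨(Fintype.equivOfCardEq (Fintype.card_fin (Fintype.card (Fin n)))).symm.trans
    (finCongr (Fintype.card_fin n)), fun _ => (orderedEigenvalue_eq hA _).symm⟩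

theorem exists_eigenbasis {A : Matrix (Fin n) (Fin n) 𝕜} (hA : A.IsHermitian) :
    ∃ e : OrthonormalBasis (Fin n) 𝕜 (EuclideanSpace 𝕜 (Fin n)),
      Matrix.toEuclideanLin A = frameOp e fun i : Fin n => orderedEigenvalue A i := by
  obtain ⟨σ, hσ⟩ := exists_equiv_eigenvalues_eq hA
  refine ⟨hA.eigenvectorBasis.reindex σ, eq_frameOp_of_apply_eq_smul _ fun i => ?_⟩
  simpa [hσ] using toEuclideanLin_eigenvectorBasis hA (σ.symm i)

theorem exists_equiv_of_map_univ_eq {α β γ : Type*} [Fintype α] [Fintype β] {f : α → γ} {g : β → γ}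
    (h : Finset.univ.val.map f = Finset.univ.val.map g) : ∃ F : α ≃ β, ∀ a, g (F a) = f a := by
  classical
  have hfiber : ∀ c, Nonempty ({a // f a = c} ≃ {b // g b = c}) := fun c => by
    have hc := congrArg (Multiset.count c) h
    rw [Multiset.count_map, Multiset.count_map] at hc
    refine ⟨Fintype.equivOfCardEq ?_⟩
    simpa only [Fintype.card_subtype, Finset.card_def, Finset.filter_val, eq_comm (a := c)] using hc
  exact ⟨Equiv.ofFiberEquiv fun c => (hfiber c).some, Equiv.ofFiberEquiv_map _⟩

theorem HasNonzeroSpectrum.map_eigenvalues {P : Matrix (Fin n) (Fin n) 𝕜} {θ : Fin r → ℝ}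
    (hP : HasNonzeroSpectrum P θ) :
    Finset.univ.val.map (Sum.elim (fun _ : Fin (n - r) => 0) θ) =
      Finset.univ.val.map hP.1.eigenvalues := by
  have hprod : P.charpoly = ∏ i : Fin (n - r) ⊕ Fin r, (Polynomial.X - Polynomial.C
      ((Sum.elim (fun _ => 0) θ i : ℝ) : 𝕜)) := by
    simp [hP.2, Fintype.prod_sum_type]
  refine Multiset.map_injective (RCLike.ofReal_injective (K := 𝕜)) ?_
  rw [Multiset.map_map, Multiset.map_map, ← hP.1.roots_charpoly_eq_eigenvalues, hprod,
    Polynomial.roots_prod _ _ (Finset.prod_ne_zero_iff.2 fun _ _ => Polynomial.X_sub_C_ne_zero _)]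
  simp

theorem HasNonzeroSpectrum.exists_frame {P : Matrix (Fin n) (Fin n) 𝕜} {θ : Fin r → ℝ}
    (hP : HasNonzeroSpectrum P θ) :
    ∃ v : Fin r → EuclideanSpace 𝕜 (Fin n), Orthonormal 𝕜 v ∧
      Matrix.toEuclideanLin P = frameOp v θ := by
  obtain ⟨F, hF⟩ := exists_equiv_of_map_univ_eq hP.map_eigenvalues
  let e := hP.1.eigenvectorBasis
  refine ⟨fun k => e (F (Sum.inr k)),
    e.orthonormal.comp _ (F.injective.comp Sum.inr_injective), LinearMap.ext fun w => ?_⟩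
  rw [eq_frameOp_of_apply_eq_smul e (toEuclideanLin_eigenvectorBasis hP.1), frameOp_apply,
    frameOp_apply, ← F.sum_comp, Fintype.sum_sum_type]
  simp [hF]

theorem re_trace_mul_self {M : Matrix (Fin n) (Fin n) 𝕜} (hM : M.IsHermitian)
    (e : OrthonormalBasis (Fin n) 𝕜 (EuclideanSpace 𝕜 (Fin n))) :
    RCLike.re (M * M).trace = ∑ i, ‖Matrix.toEuclideanLin M (e i)‖ ^ 2 := by
  have htrace : (M * M).trace = LinearMap.trace 𝕜 _ (Matrix.toEuclideanLin (M * M)) :=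
    ((M * M).trace_toLin_eq (PiLp.basisFun 2 𝕜 (Fin n))).symm
  rw [htrace, LinearMap.trace_eq_sum_inner _ e, map_sum]
  refine Finset.sum_congr rfl fun i _ => ?_
  rw [toEuclideanLin_mul_apply, ← Matrix.isSymmetric_toEuclideanLin_iff.2 hM, inner_self_eq_norm_sq]

/-- The squared Hilbert–Schmidt norm of `P B P`. -/
def compressionEnergy (P B : Matrix (Fin n) (Fin n) 𝕜) : ℝ :=
  RCLike.re (Matrix.trace (P * B * P * (P * B * P)))

theorem isHermitian_of_eq_frameOp {κ : Type*} [Fintype κ] {P : Matrix (Fin n) (Fin n) 𝕜}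
    {v : κ → EuclideanSpace 𝕜 (Fin n)} {θ : κ → ℝ} (hP : Matrix.toEuclideanLin P = frameOp v θ) :
    P.IsHermitian := by
  rw [← Matrix.isSymmetric_toEuclideanLin_iff, hP]
  exact isSymmetric_frameOp v θ

theorem compressionEnergy_eq_sum {P B : Matrix (Fin n) (Fin n) 𝕜}
    {v : Fin r → EuclideanSpace 𝕜 (Fin n)} {θ : Fin r → ℝ} (hv : Orthonormal 𝕜 v)
    (hP : Matrix.toEuclideanLin P = frameOp v θ) (hB : B.IsHermitian) :
    compressionEnergy P B = ∑ k, ∑ l, θ k ^ 2 * θ l ^ 2 *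
      ‖⟪v k, Matrix.toEuclideanLin B (v l)⟫_𝕜‖ ^ 2 := by
  have hPs := isHermitian_of_eq_frameOp hP
  have hM : (P * B * P).IsHermitian := by
    simpa only [hPs.eq] using Matrix.isHermitian_mul_mul_conjTranspose P hB
  let e := EuclideanSpace.basisFun (Fin n) 𝕜
  calc compressionEnergy P B
      = ∑ i, ∑ k, θ k ^ 2 *
          ‖⟪v k, Matrix.toEuclideanLin B (Matrix.toEuclideanLin P (e i))⟫_𝕜‖ ^ 2 := by
        rw [compressionEnergy, re_trace_mul_self hM e]
        refine Finset.sum_congr rfl fun i _ => ?_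
        rw [toEuclideanLin_mul_apply, toEuclideanLin_mul_apply, hP, norm_frameOp_sq hv]
    _ = ∑ k, θ k ^ 2 *
          ‖Matrix.toEuclideanLin P (Matrix.toEuclideanLin B (v k))‖ ^ 2 := by
        rw [Finset.sum_comm]
        refine Finset.sum_congr rfl fun k _ => ?_
        rw [← Finset.mul_sum, ← e.sum_sq_norm_inner_left]
        simp only [← Matrix.isSymmetric_toEuclideanLin_iff.2 hB (v k),
          ← Matrix.isSymmetric_toEuclideanLin_iff.2 hPs (Matrix.toEuclideanLin B (v k))]
    _ = _ := by
        refine Finset.sum_congr rfl fun k _ => ?_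
        rw [hP, norm_frameOp_sq hv, Finset.mul_sum]
        refine Finset.sum_congr rfl fun l _ => ?_
        rw [norm_inner_symm, Matrix.isSymmetric_toEuclideanLin_iff.2 hB, mul_assoc]

theorem kerSub_eq_span {P : Matrix (Fin n) (Fin n) 𝕜} {v : Fin r → EuclideanSpace 𝕜 (Fin n)}
    {θ : Fin r → ℝ} (hv : Orthonormal 𝕜 v) (hP : Matrix.toEuclideanLin P = frameOp v θ)
    {t : ℝ} (ht : t ≠ 0) :
    kerSub P t = Submodule.span 𝕜 (v '' ({k | θ k = t} : Finset (Fin r))) := by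
  ext x
  rw [← frameOp_eq_smul_iff_mem_span hv θ ht, ← hP, kerSub, LinearMap.mem_ker, map_sub, map_smul,
    toEuclideanLin_one, LinearMap.sub_apply, sub_eq_zero, eq_comm]
  rfl

theorem iSup_kerSub_eq_span {P : Matrix (Fin n) (Fin n) 𝕜} {v : Fin r → EuclideanSpace 𝕜 (Fin n)}
    {θ : Fin r → ℝ} (hv : Orthonormal 𝕜 v) (hP : Matrix.toEuclideanLin P = frameOp v θ)
    (hθ : ∀ i, θ i ≠ 0) (t : ℝ) :
    ⨆ j : {j : Fin r // θ j ≠ t}, kerSub P (θ j) =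
      Submodule.span 𝕜 (v '' ({k | θ k ≠ t} : Finset (Fin r))) := by
  simp only [kerSub_eq_span hv hP (hθ _), ← Submodule.span_iUnion, ← Set.image_iUnion]
  congr 2
  ext k
  simpa using ⟨fun ⟨_, hj, hk⟩ => hk ▸ hj, fun hk => ⟨k, hk, rfl⟩⟩

theorem exists_isHermitian_charpoly_perturbed_eq {X P : Matrix (Fin n) (Fin n) 𝕜}
    {b : OrthonormalBasis (Fin n) 𝕜 (EuclideanSpace 𝕜 (Fin n))} {x : Fin n → ℝ}
    (hx : ∀ i, 0 ≤ x i) (hX : Matrix.toEuclideanLin X = frameOp b x) (hP : P.IsHermitian) :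
    ∃ H : Matrix (Fin n) (Fin n) 𝕜, H.IsHermitian ∧ (perturbed X P).charpoly = H.charpoly ∧
      ∀ w, ⟪w, Matrix.toEuclideanLin H w⟫_𝕜 = ⟪w, frameOp (𝕜 := 𝕜) b x w⟫_𝕜 +
        ⟪frameOp (𝕜 := 𝕜) b (fun i => √(x i)) w,
          Matrix.toEuclideanLin P (frameOp (𝕜 := 𝕜) b (fun i => √(x i)) w)⟫_𝕜 := by
  let Y : Matrix (Fin n) (Fin n) 𝕜 := Matrix.toEuclideanLin.symm (frameOp b fun i => √(x i))
  have hY : Matrix.toEuclideanLin Y = frameOp b fun i => √(x i) := LinearEquiv.apply_symm_apply _ _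
  have hYY : Y * Y = X := by
    refine Matrix.toEuclideanLin.injective (LinearMap.ext fun w => ?_)
    rw [toEuclideanLin_mul_apply, hY, frameOp_frameOp b.orthonormal, hX]
    congr 2
    exact funext fun i => Real.mul_self_sqrt (hx i)
  have hYs : Y.IsHermitian := isHermitian_of_eq_frameOp hY
  refine ⟨Y * (1 + P) * Y, ?_, ?_, fun w => ?_⟩
  · simpa only [hYs.eq] using
      Matrix.isHermitian_mul_mul_conjTranspose Y (Matrix.isHermitian_one.add hP)
  · rw [perturbed, ← hYY, Matrix.mul_assoc, Matrix.charpoly_mul_comm]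
  · rw [← hX, ← hYY, toEuclideanLin_mul_apply, toEuclideanLin_mul_apply, toEuclideanLin_mul_apply,
      ← Matrix.isSymmetric_toEuclideanLin_iff.2 hYs, ← Matrix.isSymmetric_toEuclideanLin_iff.2 hYs,
      map_add, toEuclideanLin_one, LinearMap.add_apply, inner_add_right, hY, LinearMap.id_apply]

theorem exists_eigenbasis_perturbed {X P : Matrix (Fin n) (Fin n) 𝕜}
    {b : OrthonormalBasis (Fin n) 𝕜 (EuclideanSpace 𝕜 (Fin n))} {x : Fin n → ℝ}
    (hx : ∀ i, 0 ≤ x i) (hX : Matrix.toEuclideanLin X = frameOp b x)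
    {v : Fin r → EuclideanSpace 𝕜 (Fin n)} {θ : Fin r → ℝ}
    (hP : Matrix.toEuclideanLin P = frameOp v θ) :
    (Antitone fun i : Fin n => orderedEigenvalue (perturbed X P) i) ∧
    ∃ e : OrthonormalBasis (Fin n) 𝕜 (EuclideanSpace 𝕜 (Fin n)), ∀ w,
      ∑ i : Fin n, orderedEigenvalue (perturbed X P) i * ‖⟪e i, w⟫_𝕜‖ ^ 2 =
        ∑ i, x i * ‖⟪b i, w⟫_𝕜‖ ^ 2 +
          ∑ k, θ k * ‖⟪v k, frameOp (𝕜 := 𝕜) b (fun i => √(x i)) w⟫_𝕜‖ ^ 2 := by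
  obtain ⟨H, hH, hχ, hform⟩ :=
    exists_isHermitian_charpoly_perturbed_eq hx hX (isHermitian_of_eq_frameOp hP)
  have hordered : orderedEigenvalue (perturbed X P) = orderedEigenvalue H := by
    unfold orderedEigenvalue
    rw [hχ]
  obtain ⟨e, he⟩ := exists_eigenbasis hH
  rw [hordered]
  refine ⟨orderedEigenvalue_antitone hH, e, fun w => ?_⟩
  have h := hform w
  rw [he, hP, inner_frameOp_self, inner_frameOp_self, inner_frameOp_self] at h
  exact_mod_cast h

end MatrixStructure

section TTransform

theorem ae_mem_Icc_of_support {μ : Measure ℝ} {a b : ℝ} (ha : IsGLB μ.support a)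
    (hb : IsLUB μ.support b) : ∀ᵐ t ∂μ, t ∈ Set.Icc a b := by
  filter_upwards [Measure.support_mem_ae (μ := μ)] with t ht
  exact ⟨ha.1 ht, hb.1 ht⟩

theorem sub_ne_zero_of_notMem_Icc {a b z t : ℝ} (hz : z ∉ Set.Icc a b) (ht : t ∈ Set.Icc a b) :
    z - t ≠ 0 :=
  fun h => hz (by rwa [sub_eq_zero.1 h])

theorem continuousOn_div_sub {a b z : ℝ} (hz : z ∉ Set.Icc a b) :
    ContinuousOn (fun t => t / (z - t)) (Set.Icc a b) :=
  continuousOn_id.div (continuousOn_const.sub continuousOn_id) fun _ ht =>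
    sub_ne_zero_of_notMem_Icc hz ht

theorem continuousOn_div_sub_sq {a b z : ℝ} (hz : z ∉ Set.Icc a b) :
    ContinuousOn (fun t => t / (z - t) ^ 2) (Set.Icc a b) :=
  continuousOn_id.div ((continuousOn_const.sub continuousOn_id).pow 2) fun _ ht =>
    pow_ne_zero 2 (sub_ne_zero_of_notMem_Icc hz ht)

theorem integrable_of_continuousOn_Icc {μ : Measure ℝ} [IsFiniteMeasure μ] {a b : ℝ} {f : ℝ → ℝ}
    (hμ : ∀ᵐ t ∂μ, t ∈ Set.Icc a b) (hf : ContinuousOn f (Set.Icc a b)) : Integrable f μ := by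
  rw [← Measure.restrict_eq_self_of_ae_mem hμ]
  exact hf.integrableOn_compact isCompact_Icc

section FiniteMeasure

variable {μ : Measure ℝ} [IsFiniteMeasure μ] {a b : ℝ} (hμ : ∀ᵐ t ∂μ, t ∈ Set.Icc a b)
include hμ

theorem hasDerivAt_tTransform {z : ℝ} (hz : z ∉ Set.Icc a b) :
    HasDerivAt (tTransform μ) (-∫ t, t / (z - t) ^ 2 ∂μ) z := by
  obtain ⟨d, hd, hball⟩ := Metric.isOpen_iff.1 isClosed_Icc.isOpen_compl z hz
  have hout : ∀ w ∈ Metric.ball z (d / 2), w ∉ Set.Icc a b := fun w hw =>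
    hball (Metric.ball_subset_ball (half_le_self hd.le) hw)
  have hdist : ∀ w ∈ Metric.ball z (d / 2), ∀ t ∈ Set.Icc a b, d / 2 ≤ |w - t| := by
    intro w hw t ht
    have hzt : d ≤ |z - t| := by
      rw [abs_sub_comm]
      exact not_lt.1 fun h => hball h ht
    have hzw : |z - w| < d / 2 := by
      rw [abs_sub_comm]
      exact hw
    linarith [abs_sub_le z w t]
  have hs : Metric.ball z (d / 2) ∈ 𝓝 z := Metric.ball_mem_nhds z (half_pos hd)
  rw [← integral_neg]
  refine (hasDerivAt_integral_of_dominated_loc_of_deriv_le (μ := μ)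
    (F := fun z t => t / (z - t)) (F' := fun z t => -(t / (z - t) ^ 2)) (s := Metric.ball z (d / 2))
    (bound := fun t => |t| / (d / 2) ^ 2) hs ?_ ?_ ?_ ?_ ?_ ?_).2
  · filter_upwards [hs] with w hw
    exact (integrable_of_continuousOn_Icc hμ
      (continuousOn_div_sub (hout w hw))).aestronglyMeasurable
  · exact integrable_of_continuousOn_Icc hμ (continuousOn_div_sub hz)
  · exact (integrable_of_continuousOn_Icc hμ (continuousOn_div_sub_sq hz).neg).aestronglyMeasurable
  · filter_upwards [hμ] with t ht w hw
    rw [norm_neg, Real.norm_eq_abs, abs_div, abs_pow]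
    have := hdist w hw t ht
    gcongr
  · exact integrable_of_continuousOn_Icc hμ (by fun_prop)
  · filter_upwards [hμ] with t ht w hw
    refine ((hasDerivAt_const w t).div ((hasDerivAt_id w).sub_const t)
      (sub_ne_zero_of_notMem_Icc (hout w hw) ht)).congr_deriv ?_
    simp only [id_eq]
    ring

theorem tendsto_tTransform_cobounded :
    Tendsto (tTransform μ) (Bornology.cobounded ℝ) (𝓝 0) := by
  have hfar : ∀ᶠ z in Bornology.cobounded ℝ, z ∉ Set.Icc (a - 1) (b + 1) :=
    Bornology.isBounded_def.1 (Metric.isBounded_Icc _ _)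
  have : (Bornology.cobounded ℝ).IsCountablyGenerated := by
    rw [IsOrderBornology.cobounded_eq]
    infer_instance
  rw [← integral_zero ℝ ℝ (μ := μ)]
  refine tendsto_integral_filter_of_dominated_convergence (fun t => |t|) ?_ ?_
    (integrable_of_continuousOn_Icc hμ continuousOn_id.abs) (Eventually.of_forall fun t => ?_)
  · filter_upwards [hfar] with z hz
    have hz' : z ∉ Set.Icc a b := fun h => hz ⟨by linarith [h.1], by linarith [h.2]⟩
    exact (integrable_of_continuousOn_Icc hμ (continuousOn_div_sub hz')).aestronglyMeasurable
  · filter_upwards [hfar] with z hz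
    filter_upwards [hμ] with t ht
    rw [norm_div, Real.norm_eq_abs, Real.norm_eq_abs]
    refine div_le_self (abs_nonneg t) (le_of_not_gt fun h => hz ?_)
    rw [abs_lt] at h
    exact ⟨by linarith [ht.1], by linarith [ht.2]⟩
  · have hsub : Tendsto (fun z : ℝ => z - t) (Bornology.cobounded ℝ) (Bornology.cobounded ℝ) :=
      tendsto_sub_const_cobounded t
    simpa only [div_eq_mul_inv, mul_zero, Function.comp_apply] using
      (tendsto_inv₀_cobounded.comp hsub).const_mul t

theorem integral_sq_div_sub_sq {z : ℝ} (hz : z ∉ Set.Icc a b) :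
    ∫ t, (t / (z - t)) ^ 2 ∂μ = -(z * deriv (tTransform μ) z) - tTransform μ z := by
  rw [(hasDerivAt_tTransform hμ hz).deriv, tTransform, mul_neg, neg_neg, ← integral_const_mul,
    ← integral_sub ((integrable_of_continuousOn_Icc hμ (continuousOn_div_sub_sq hz)).const_mul z)
      (integrable_of_continuousOn_Icc hμ (continuousOn_div_sub hz))]
  refine integral_congr_ae ?_
  filter_upwards [hμ] with t ht
  have := sub_ne_zero_of_notMem_Icc hz ht
  field_simp
  ring

end FiniteMeasure

theorem integral_pos_of_ne_dirac {μ : Measure ℝ} [IsProbabilityMeasure μ]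
    (hμ0 : μ ≠ Measure.dirac 0) {f : ℝ → ℝ} (hf : Integrable f μ)
    (hnonneg : ∀ᵐ t ∂μ, 0 ≤ f t) (hzero : ∀ᵐ t ∂μ, f t = 0 → t = 0) : 0 < ∫ t, f t ∂μ := by
  refine lt_of_le_of_ne (integral_nonneg_of_ae hnonneg) fun h => hμ0 ?_
  have hid : (fun t : ℝ => t) =ᵐ[μ] fun _ => 0 := by
    filter_upwards [(integral_eq_zero_iff_of_nonneg_ae hnonneg hf).1 h.symm, hzero]
      with t ht ht0 using ht0 ht
  have hmap := Measure.map_congr (mβ := Real.measurableSpace) hid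
  rwa [Measure.map_id', Measure.map_const, measure_univ, one_smul] at hmap

variable {μ : Measure ℝ} {a b : ℝ} (hμ : ∀ᵐ t ∂μ, t ∈ Set.Icc a b) (ha0 : 0 ≤ a)
include hμ ha0

theorem tTransform_nonneg {z : ℝ} (hz : b < z) : 0 ≤ tTransform μ z :=
  integral_nonneg_of_ae <| hμ.mono fun _ ht =>
    div_nonneg (ha0.trans ht.1) (sub_nonneg.2 (ht.2.trans hz.le))

theorem tTransform_nonpos {z : ℝ} (hz : z < a) : tTransform μ z ≤ 0 :=
  integral_nonpos_of_ae <| hμ.mono fun _ ht =>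
    div_nonpos_of_nonneg_of_nonpos (ha0.trans ht.1) (sub_nonpos.2 (hz.le.trans ht.1))

theorem lt_of_tTransform_pos {z : ℝ} (hz : z ∉ Set.Icc a b) (hT : 0 < tTransform μ z) : b < z :=
  lt_of_not_ge fun hzb =>
    hT.not_ge (tTransform_nonpos hμ ha0 (lt_of_not_ge fun haz => hz ⟨haz, hzb⟩))

theorem lt_of_tTransform_neg {z : ℝ} (hz : z ∉ Set.Icc a b) (hT : tTransform μ z < 0) : z < a :=
  lt_of_not_ge fun haz =>
    hT.not_ge (tTransform_nonneg hμ ha0 (lt_of_not_ge fun hzb => hz ⟨haz, hzb⟩))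

variable [IsProbabilityMeasure μ] (hμ0 : μ ≠ Measure.dirac 0)
include hμ0

theorem integral_div_sub_sq_pos {z : ℝ} (hz : z ∉ Set.Icc a b) :
    0 < ∫ t, t / (z - t) ^ 2 ∂μ := by
  refine integral_pos_of_ne_dirac hμ0
    (integrable_of_continuousOn_Icc hμ (continuousOn_div_sub_sq hz)) ?_ ?_
  · filter_upwards [hμ] with t ht
    exact div_nonneg (ha0.trans ht.1) (sq_nonneg _)
  · filter_upwards [hμ] with t ht h
    exact (div_eq_zero_iff.1 h).resolve_right (pow_ne_zero 2 (sub_ne_zero_of_notMem_Icc hz ht))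

theorem strictAntiOn_tTransform {s : Set ℝ} (hs : Convex ℝ s) (hso : IsOpen s)
    (hsd : ∀ z ∈ s, z ∉ Set.Icc a b) : StrictAntiOn (tTransform μ) s := by
  refine strictAntiOn_of_deriv_neg hs
    (fun z hz => (hasDerivAt_tTransform hμ (hsd z hz)).continuousAt.continuousWithinAt) ?_
  intro z hz
  rw [hso.interior_eq] at hz
  rw [(hasDerivAt_tTransform hμ (hsd z hz)).deriv, neg_lt_zero]
  exact integral_div_sub_sq_pos hμ ha0 hμ0 (hsd z hz)

theorem strictAntiOn_tTransform_Ioi : StrictAntiOn (tTransform μ) (Set.Ioi b) :=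
  strictAntiOn_tTransform hμ ha0 hμ0 (convex_Ioi b) isOpen_Ioi
    fun _ hz h => not_le.2 hz h.2

theorem strictAntiOn_tTransform_Iio : StrictAntiOn (tTransform μ) (Set.Iio a) :=
  strictAntiOn_tTransform hμ ha0 hμ0 (convex_Iio a) isOpen_Iio
    fun _ hz h => not_le.2 hz h.1

theorem exists_lt_tTransform {c : ℝ} (hc : (c : EReal) < tTransformRight μ b) :
    ∃ z, b < z ∧ c < tTransform μ z := by
  have hanti : AntitoneOn (fun z => (tTransform μ z : EReal)) (Set.Ioi b) := fun x hx y hy hxy =>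
    EReal.coe_le_coe_iff.2 ((strictAntiOn_tTransform_Ioi hμ ha0 hμ0).antitoneOn hx hy hxy)
  have hlim := tendsto_rightLim_of_tendsto (f := fun z => (tTransform μ z : EReal))
    ⟨_, MonotoneOn.tendsto_nhdsGT (β := ERealᵒᵈ) hanti.dual_right (OrderBot.bddBelow _)⟩
  obtain ⟨z, hz, hzb⟩ := ((hlim.eventually (lt_mem_nhds hc)).and self_mem_nhdsWithin).exists
  exact ⟨z, hzb, EReal.coe_lt_coe_iff.1 hz⟩

theorem exists_tTransform_lt {c : ℝ} (hc : tTransformLeft μ a < (c : EReal)) :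
    ∃ z, z < a ∧ tTransform μ z < c := by
  have hanti : AntitoneOn (fun z => (tTransform μ z : EReal)) (Set.Iio a) := fun x hx y hy hxy =>
    EReal.coe_le_coe_iff.2 ((strictAntiOn_tTransform_Iio hμ ha0 hμ0).antitoneOn hx hy hxy)
  have hlim := tendsto_leftLim_of_tendsto (f := fun z => (tTransform μ z : EReal))
    ⟨_, MonotoneOn.tendsto_nhdsLT (β := ERealᵒᵈ) hanti.dual_right (OrderTop.bddAbove _)⟩
  obtain ⟨z, hz, hza⟩ := ((hlim.eventually (gt_mem_nhds hc)).and self_mem_nhdsWithin).exists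
  exact ⟨z, hza, EReal.coe_lt_coe_iff.1 hz⟩

theorem exists_tTransform_eq_of_pos {c : ℝ} (hc₀ : 0 < c) (hc : (c : EReal) < tTransformRight μ b) :
    ∃ ρ, b < ρ ∧ tTransform μ ρ = c := by
  obtain ⟨z₀, hz₀, hTz₀⟩ := exists_lt_tTransform hμ ha0 hμ0 hc
  have htop := (tendsto_tTransform_cobounded hμ).mono_left IsOrderBornology.atTop_le_cobounded
  obtain ⟨z₁, hTz₁, hz₁⟩ :=
    ((htop.eventually (gt_mem_nhds hc₀)).and (eventually_ge_atTop z₀)).exists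
  have hcont : ContinuousOn (tTransform μ) (Set.Icc z₀ z₁) := fun z hz =>
    (hasDerivAt_tTransform hμ fun h =>
      (hz₀.trans_le hz.1).not_ge h.2).continuousAt.continuousWithinAt
  obtain ⟨ρ, hρ, hTρ⟩ := intermediate_value_Icc' hz₁ hcont ⟨hTz₁.le, hTz₀.le⟩
  exact ⟨ρ, hz₀.trans_le hρ.1, hTρ⟩

theorem exists_tTransform_eq_of_neg {c : ℝ} (hc₀ : c < 0) (hc : tTransformLeft μ a < (c : EReal)) :
    ∃ ρ, ρ < a ∧ tTransform μ ρ = c := by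
  obtain ⟨z₀, hz₀, hTz₀⟩ := exists_tTransform_lt hμ ha0 hμ0 hc
  have hbot := (tendsto_tTransform_cobounded hμ).mono_left IsOrderBornology.atBot_le_cobounded
  obtain ⟨z₁, hTz₁, hz₁⟩ :=
    ((hbot.eventually (lt_mem_nhds hc₀)).and (eventually_le_atBot z₀)).exists
  have hcont : ContinuousOn (tTransform μ) (Set.Icc z₁ z₀) := fun z hz =>
    (hasDerivAt_tTransform hμ fun h =>
      (hz.2.trans_lt hz₀).not_ge h.1).continuousAt.continuousWithinAt
  obtain ⟨ρ, hρ, hTρ⟩ := intermediate_value_Icc' hz₁ hcont ⟨hTz₀.le, hTz₁.le⟩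
  exact ⟨ρ, hρ.2.trans_lt hz₀, hTρ⟩

theorem exists_tTransform_eq {c : ℝ} (hc₀ : c ≠ 0) (hlow : tTransformLeft μ a < (c : EReal))
    (hup : (c : EReal) < tTransformRight μ b) :
    ∃ ρ ∉ Set.Icc a b, tTransform μ ρ = c := by
  rcases hc₀.lt_or_gt with hc₀ | hc₀
  · obtain ⟨ρ, hρ, hTρ⟩ := exists_tTransform_eq_of_neg hμ ha0 hμ0 hc₀ hlow
    exact ⟨ρ, fun h => hρ.not_ge h.1, hTρ⟩
  · obtain ⟨ρ, hρ, hTρ⟩ := exists_tTransform_eq_of_pos hμ ha0 hμ0 hc₀ hup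
    exact ⟨ρ, fun h => hρ.not_ge h.2, hTρ⟩

theorem eq_of_tTransform_eq {ρ z : ℝ} (hρ : ρ ∉ Set.Icc a b) (hz : z ∉ Set.Icc a b)
    (hT₀ : tTransform μ ρ ≠ 0) (hT : tTransform μ z = tTransform μ ρ) : z = ρ := by
  rcases hT₀.lt_or_gt with hneg | hpos
  · exact (strictAntiOn_tTransform_Iio hμ ha0 hμ0).injOn
      (lt_of_tTransform_neg hμ ha0 hz (hT ▸ hneg)) (lt_of_tTransform_neg hμ ha0 hρ hneg) hT
  · exact (strictAntiOn_tTransform_Ioi hμ ha0 hμ0).injOn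
      (lt_of_tTransform_pos hμ ha0 hz (hT ▸ hpos)) (lt_of_tTransform_pos hμ ha0 hρ hpos) hT

end TTransform

section IsotropicLimit

variable {𝕜 : Type*} [RCLike 𝕜] {κ : Type*}

theorem dist_inner_frameOp_le {ι E : Type*} [Fintype ι] [NormedAddCommGroup E]
    [InnerProductSpace 𝕜 E] {e : ι → E} (he : Orthonormal 𝕜 e) {f g : ι → ℝ} {δ : ℝ} (hδ : 0 ≤ δ)
    (hfg : ∀ i, |f i - g i| ≤ δ) {v : κ → E} (hv : Orthonormal 𝕜 v) (k l : κ) :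
    dist ⟪v k, frameOp (𝕜 := 𝕜) e f (v l)⟫_𝕜 ⟪v k, frameOp (𝕜 := 𝕜) e g (v l)⟫_𝕜 ≤ δ := by
  rw [dist_eq_norm, ← inner_sub_right, ← LinearMap.sub_apply, ← frameOp_sub]
  have hle := norm_inner_frameOp_le (f := f - g) he hδ hfg (v k) (v l)
  rwa [hv.1, hv.1, mul_one, mul_one] at hle

variable [DecidableEq κ]

/-- Along the sequence of eigenbases `e n` with eigenvalues `x n`, the eigenvalues concentrate on
`[a, b]`, and the spectral measures of the orthonormal frames `v n`, tested on monomials, are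
asymptotically those of a family of `κ` independent isotropic directions: the diagonal ones
converge to `μ` and the mixed ones to `0`. -/
structure IsotropicLimit (μ : Measure ℝ) (a b : ℝ)
    (e : ∀ n, OrthonormalBasis (Fin n) 𝕜 (EuclideanSpace 𝕜 (Fin n))) (x : ∀ n, Fin n → ℝ)
    (v : ∀ n, κ → EuclideanSpace 𝕜 (Fin n)) : Prop where
  orthonormal : ∀ᶠ n in atTop, Orthonormal 𝕜 (v n)
  eventually_mem : ∀ U ∈ 𝓝ˢ (Set.Icc a b), ∀ᶠ n in atTop, ∀ i, x n i ∈ U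
  moment : ∀ (m : ℕ) (k l : κ),
    Tendsto (fun n => ⟪v n k, frameOp (𝕜 := 𝕜) (e n) (x n ^ m) (v n l)⟫_𝕜) atTop
      (𝓝 (if k = l then ((∫ t, t ^ m ∂μ : ℝ) : 𝕜) else 0))

namespace IsotropicLimit

variable {μ : Measure ℝ} {a b : ℝ}
  {e : ∀ n, OrthonormalBasis (Fin n) 𝕜 (EuclideanSpace 𝕜 (Fin n))} {x : ∀ n, Fin n → ℝ}
  {v : ∀ n, κ → EuclideanSpace 𝕜 (Fin n)} (h : IsotropicLimit μ a b e x v)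
include h

theorem eventually_forall {p : ℝ → ℝ → Prop} {ρ : ℝ} {l : ℕ → ℝ} (hl : Tendsto l atTop (𝓝 ρ))
    (hp : ∀ t ∈ Set.Icc a b, ∀ᶠ q : ℝ × ℝ in 𝓝 (ρ, t), p q.1 q.2) :
    ∀ᶠ n in atTop, ∀ i, p (l n) (x n i) := by
  have htube : ∀ᶠ q : ℝ × ℝ in 𝓝ˢ {ρ} ×ˢ 𝓝ˢ (Set.Icc a b), p q.1 q.2 := by
    rw [← isCompact_singleton.nhdsSet_prod_eq isCompact_Icc, eventually_nhdsSet_iff_forall]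
    rintro ⟨ρ', t⟩ ⟨rfl, ht⟩
    exact hp t ht
  obtain ⟨U, hU, V, hV, hUV⟩ := mem_prod_iff.1 htube
  rw [nhdsSet_singleton] at hU
  filter_upwards [hl.eventually_mem hU, h.eventually_mem V hV] with n hln hx i
  exact hUV (Set.mk_mem_prod hln (hx i))

variable (hμ : ∀ᵐ t ∂μ, t ∈ Set.Icc a b) [IsProbabilityMeasure μ]
include hμ

theorem tendsto_polynomial (p : Polynomial ℝ) (k l : κ) :
    Tendsto (fun n => ⟪v n k, frameOp (𝕜 := 𝕜) (e n) (fun i => p.eval (x n i)) (v n l)⟫_𝕜) atTop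
      (𝓝 (if k = l then ((∫ t, p.eval t ∂μ : ℝ) : 𝕜) else 0)) := by
  have hinteg : ∀ q : Polynomial ℝ, Integrable (fun t => q.eval t) μ := fun q =>
    integrable_of_continuousOn_Icc hμ q.continuousOn
  induction p using Polynomial.induction_on' with
  | add p q hp hq =>
    convert hp.add hq using 2 with n
    · rw [← inner_add_right, ← LinearMap.add_apply, ← frameOp_add]
      simp only [Polynomial.eval_add]
      rfl
    · simp only [Polynomial.eval_add, integral_add (hinteg p) (hinteg q)]
      split_ifs <;> simp
  | monomial m c =>
    convert (h.moment m k l).const_mul (c : 𝕜) using 2 with n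
    · rw [← inner_smul_right, ← LinearMap.smul_apply, ← frameOp_smul]
      simp only [Polynomial.eval_monomial]
      rfl
    · simp only [Polynomial.eval_monomial, integral_const_mul]
      split_ifs <;> simp

theorem tendsto_inner_frameOp {f : ℝ → ℝ → ℝ} {ρ : ℝ}
    (hf : ∀ t ∈ Set.Icc a b, ContinuousAt (Function.uncurry f) (ρ, t))
    {z : ℕ → ℝ} (hz : Tendsto z atTop (𝓝 ρ)) (k l : κ) :
    Tendsto (fun n => ⟪v n k, frameOp (𝕜 := 𝕜) (e n) (fun i => f (z n) (x n i)) (v n l)⟫_𝕜) atTop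
      (𝓝 (if k = l then ((∫ t, f ρ t ∂μ : ℝ) : 𝕜) else 0)) := by
  have hfρ : ContinuousOn (f ρ) (Set.Icc a b) := fun t ht =>
    ((hf t ht).comp (f := fun t => (ρ, t)) (by fun_prop)).continuousWithinAt
  rw [Metric.tendsto_nhds]
  intro ε hε
  obtain ⟨p, hp⟩ := exists_polynomial_near_of_continuousOn a b (f ρ) hfρ (ε / 3) (by positivity)
  have hnear : ∀ᶠ n in atTop, ∀ i, |f (z n) (x n i) - p.eval (x n i)| < ε / 3 := by
    refine h.eventually_forall hz (p := fun z t => |f z t - p.eval t| < ε / 3) fun t ht => ?_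
    have hcont : ContinuousAt (fun q : ℝ × ℝ => |f q.1 q.2 - p.eval q.2|) (ρ, t) :=
      ((hf t ht).sub (p.continuous.comp continuous_snd).continuousAt).abs
    exact hcont.eventually_lt_const (by simpa only [abs_sub_comm] using hp t ht)
  have hlim : dist (if k = l then ((∫ t, p.eval t ∂μ : ℝ) : 𝕜) else 0)
      (if k = l then ((∫ t, f ρ t ∂μ : ℝ) : 𝕜) else 0) ≤ ε / 3 := by
    split_ifs
    · rw [dist_eq_norm, ← RCLike.ofReal_sub, RCLike.norm_ofReal, ← integral_sub
        (integrable_of_continuousOn_Icc hμ p.continuousOn) (integrable_of_continuousOn_Icc hμ hfρ)]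
      simpa using norm_integral_le_of_norm_le_const (C := ε / 3)
        (f := fun t => p.eval t - f ρ t) (hμ.mono fun t ht => (hp t ht).le)
    · rw [dist_self]
      positivity
  filter_upwards [hnear, h.orthonormal, Metric.tendsto_nhds.1 (h.tendsto_polynomial hμ p k l)
    (ε / 3) (by positivity)] with n hn hv hpoly
  have happrox := dist_inner_frameOp_le (e n).orthonormal (by positivity) (fun i => (hn i).le) hv
    k l
  linarith [dist_triangle4 ⟪v n k, frameOp (𝕜 := 𝕜) (e n) (fun i => f (z n) (x n i)) (v n l)⟫_𝕜
    ⟪v n k, frameOp (𝕜 := 𝕜) (e n) (fun i => p.eval (x n i)) (v n l)⟫_𝕜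
    (if k = l then ((∫ t, p.eval t ∂μ : ℝ) : 𝕜) else 0)
    (if k = l then ((∫ t, f ρ t ∂μ : ℝ) : 𝕜) else 0)]

theorem gramTendsto {f : ℝ → ℝ → ℝ} {ρ : ℝ}
    (hf : ∀ t ∈ Set.Icc a b, ContinuousAt (Function.uncurry f) (ρ, t))
    {z : ℕ → ℝ} (hz : Tendsto z atTop (𝓝 ρ)) :
    GramTendsto 𝕜 (fun n k => frameOp (𝕜 := 𝕜) (e n) (fun i => f (z n) (x n i)) (v n k)) atTop
      (∫ t, f ρ t ^ 2 ∂μ) := by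
  intro k l
  have hsq : ∀ t ∈ Set.Icc a b, ContinuousAt (Function.uncurry fun z t => f z t ^ 2) (ρ, t) :=
    fun t ht => (hf t ht).pow 2
  refine (h.tendsto_inner_frameOp hμ hsq hz k l).congr fun n => ?_
  rw [isSymmetric_frameOp, frameOp_frameOp (e n).orthonormal]
  simp only [sq]
  rfl

end IsotropicLimit

end IsotropicLimit

section Outliers

variable {𝕜 : Type*} [RCLike 𝕜]

/-- `A` is the inverse square root of the operator with eigenvalues `ε * (z - x i)`. -/
theorem exists_resolvent_substitution {E ι κ : Type*} [NormedAddCommGroup E]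
    [InnerProductSpace 𝕜 E] [Fintype ι] [Fintype κ] (b : OrthonormalBasis ι 𝕜 E) {x : ι → ℝ}
    (hx : ∀ i, 0 ≤ x i) {ε z : ℝ} (hN : ∀ i, 0 < ε * (z - x i)) (v : κ → E) (θ : κ → ℝ) :
    ∃ A : E ≃ₗ[𝕜] E, ∀ y,
      ε * z * ‖A y‖ ^ 2 - ε * (∑ i, x i * ‖⟪b i, A y⟫_𝕜‖ ^ 2 +
          ∑ k, θ k * ‖⟪v k, frameOp (𝕜 := 𝕜) b (fun i => √(x i)) (A y)⟫_𝕜‖ ^ 2) =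
        ‖y‖ ^ 2 - ∑ k, ε * θ k *
          ‖⟪frameOp (𝕜 := 𝕜) b (fun i => √(x i / (ε * (z - x i)))) (v k), y⟫_𝕜‖ ^ 2 := by
  set N : ι → ℝ := fun i => √(ε * (z - x i))
  have hN₀ : ∀ i, N i ≠ 0 := fun i => (Real.sqrt_pos.2 (hN i)).ne'
  have hinv : ∀ f g : ι → ℝ, f * g = 1 → (frameOp b f : E →ₗ[𝕜] E) ∘ₗ frameOp b g = LinearMap.id :=
    fun f g hfg => LinearMap.ext fun y => by
      rw [LinearMap.comp_apply, frameOp_frameOp b.orthonormal, hfg, frameOp_one]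
  refine ⟨LinearEquiv.ofLinearMap (frameOp b N⁻¹) (frameOp b N)
    (hinv _ _ (funext fun i => inv_mul_cancel₀ (hN₀ i)))
    (hinv _ _ (funext fun i => mul_inv_cancel₀ (hN₀ i))), fun y => ?_⟩
  set w := frameOp (𝕜 := 𝕜) b N⁻¹ y
  have hdiag : ε * z * ‖w‖ ^ 2 - ε * ∑ i, x i * ‖⟪b i, w⟫_𝕜‖ ^ 2 = ‖y‖ ^ 2 := by
    rw [← b.sum_sq_norm_inner_right w, ← b.sum_sq_norm_inner_right y, Finset.mul_sum,
      Finset.mul_sum, ← Finset.sum_sub_distrib]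
    refine Finset.sum_congr rfl fun i _ => ?_
    have hsq : ε * (z - x i) = N i ^ 2 := (Real.sq_sqrt (hN i).le).symm
    rw [inner_left_frameOp b.orthonormal, norm_mul, RCLike.norm_ofReal, mul_pow, sq_abs,
      Pi.inv_apply]
    linear_combination ((N i)⁻¹ ^ 2 * ‖⟪b i, y⟫_𝕜‖ ^ 2) * hsq
      + (‖⟪b i, y⟫_𝕜‖ ^ 2 * (1 + N i * (N i)⁻¹)) * mul_inv_cancel₀ (hN₀ i)
  have hframe : ∀ k, ⟪v k, frameOp (𝕜 := 𝕜) b (fun i => √(x i)) w⟫_𝕜 =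
      ⟪frameOp (𝕜 := 𝕜) b (fun i => √(x i / (ε * (z - x i)))) (v k), y⟫_𝕜 := fun k => by
    rw [frameOp_frameOp b.orthonormal, isSymmetric_frameOp]
    congr 3
    funext i
    exact (Real.sqrt_div (hx i) _).symm
  simp only [LinearEquiv.coe_ofLinearMap, ← hframe, mul_add, ← hdiag, Finset.mul_sum, mul_assoc]
  ring

theorem isRankedBefore_Iio {n : ℕ} {f : Fin n → ℝ} (hf : Antitone f) (i : Fin n) :
    IsRankedBefore f i (Finset.Iio i) :=
  ⟨by simp, fun _ hk => hf (Finset.mem_Iio.1 hk).le,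
    fun _ hk => hf (not_lt.1 fun h => hk (Finset.mem_Iio.2 h))⟩

theorem isRankedBefore_neg_Ioi {n : ℕ} {f : Fin n → ℝ} (hf : Antitone f) (i : Fin n) :
    IsRankedBefore (fun k => -f k) i (Finset.Ioi i) :=
  ⟨by simp, fun _ hk => neg_le_neg (hf (Finset.mem_Ioi.1 hk).le),
    fun _ hk => neg_le_neg (hf (not_lt.1 fun h => hk (Finset.mem_Ioi.2 h)))⟩

variable {r : ℕ} {θ : Fin r → ℝ} {ε : ℝ}

theorem exists_isRankedBefore_outlier (hθ : Antitone θ) (i₀ : Fin r) (hε : ε = 1 ∨ ε = -1)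
    (hp : 0 < ε * θ i₀) :
    ∃ J, IsRankedBefore (fun k => ε * θ k) i₀ J ∧ ∀ {n : ℕ} {X P : Matrix (Fin n) (Fin n) 𝕜},
      r ≤ n → (Antitone fun i : Fin n => orderedEigenvalue (perturbed X P) i) →
      ∃ (j : Fin n) (s : Finset (Fin n)), s.card = J.card ∧
        outlierEigenvalue X P θ i₀ = orderedEigenvalue (perturbed X P) j ∧
        IsRankedBefore (fun i : Fin n => ε * orderedEigenvalue (perturbed X P) i) j s := by
  rcases hε with rfl | rfl
  · simp only [one_mul] at hp ⊢
    refine ⟨_, isRankedBefore_Iio hθ i₀, fun hr hl => ⟨⟨i₀, by lia⟩, _, ?_, if_pos hp,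
      isRankedBefore_Iio hl _⟩⟩
    rw [Fin.card_Iio, Fin.card_Iio]
  · simp only [neg_mul, one_mul] at hp ⊢
    refine ⟨_, isRankedBefore_neg_Ioi hθ i₀, fun {n} _ _ hr hl => ⟨⟨n - r + i₀, by lia⟩, _, ?_,
      if_neg (by linarith), isRankedBefore_neg_Ioi hl _⟩⟩
    rw [Fin.card_Ioi, Fin.card_Ioi]
    dsimp only
    lia

theorem integral_sq_sqrt_div {μ : Measure ℝ} {a b z : ℝ} (hμ : ∀ᵐ t ∂μ, t ∈ Set.Icc a b)
    (ha0 : 0 ≤ a) (hε : ε = 1 ∨ ε = -1) (hz : ∀ t ∈ Set.Icc a b, 0 < ε * (z - t)) :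
    ∫ t, √(t / (ε * (z - t))) ^ 2 ∂μ = ε * tTransform μ z := by
  rw [tTransform, ← integral_const_mul]
  refine integral_congr_ae (hμ.mono fun t ht => ?_)
  dsimp only
  rw [Real.sq_sqrt (div_nonneg (ha0.trans ht.1) (hz t ht).le)]
  rcases hε with rfl | rfl
  · simp
  · rw [neg_one_mul, div_neg, neg_one_mul]

namespace IsotropicLimit

variable {μ : Measure ℝ} {a b : ℝ}
  {e : ∀ n, OrthonormalBasis (Fin n) 𝕜 (EuclideanSpace 𝕜 (Fin n))} {x : ∀ n, Fin n → ℝ}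
  {v : ∀ n, Fin r → EuclideanSpace 𝕜 (Fin n)} {X P : ∀ n, Matrix (Fin n) (Fin n) 𝕜}
  (h : IsotropicLimit μ a b e x v)
include h

theorem eventually_mul_sub_pos {z : ℝ} (hz : ∀ t ∈ Set.Icc a b, 0 < ε * (z - t)) :
    ∀ᶠ n in atTop, ∀ i, 0 < ε * (z - x n i) :=
  h.eventually_forall (p := fun z t => 0 < ε * (z - t)) tendsto_const_nhds fun t ht =>
    (Continuous.tendsto (by fun_prop) (z, t)).eventually_const_lt (hz t ht)

variable (hμ : ∀ᵐ t ∂μ, t ∈ Set.Icc a b) [IsProbabilityMeasure μ] (ha0 : 0 ≤ a)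
include hμ ha0

theorem gramTendsto_sqrt_div (hε : ε = 1 ∨ ε = -1) {z : ℝ}
    (hz : ∀ t ∈ Set.Icc a b, 0 < ε * (z - t)) :
    GramTendsto 𝕜
      (fun n k => frameOp (𝕜 := 𝕜) (e n) (fun i => √(x n i / (ε * (z - x n i)))) (v n k)) atTop
      (ε * tTransform μ z) := by
  rw [← integral_sq_sqrt_div hμ ha0 hε hz]
  refine h.gramTendsto hμ (f := fun z t => √(t / (ε * (z - t)))) (fun t ht => ?_)
    tendsto_const_nhds
  exact Real.continuous_sqrt.continuousAt.comp
    (ContinuousAt.div (by fun_prop) (by fun_prop) (hz t ht).ne')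

variable (hx : ∀ n i, 0 ≤ x n i) (hX : ∀ n, Matrix.toEuclideanLin (X n) = frameOp (e n) (x n))
  (hθ : Antitone θ) (hP : ∀ n, r ≤ n → Matrix.toEuclideanLin (P n) = frameOp (v n) θ)
include hx hX hθ hP

theorem eventually_mul_le_outlier (i₀ : Fin r) (hε : ε = 1 ∨ ε = -1) (hp : 0 < ε * θ i₀) {z : ℝ}
    (hz : ∀ t ∈ Set.Icc a b, 0 < ε * (z - t)) (hT : 1 < tTransform μ z * θ i₀) :
    ∀ᶠ n in atTop, ε * z ≤ ε * outlierEigenvalue (X n) (P n) θ i₀ := by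
  obtain ⟨J, hJ, hrank⟩ := exists_isRankedBefore_outlier (𝕜 := 𝕜) hθ i₀ hε hp
  have hpT : 1 < ε * θ i₀ * (ε * tTransform μ z) := by
    rcases hε with rfl | rfl <;> linarith
  have hτ : 0 < ε * tTransform μ z := pos_of_mul_pos_right (one_pos.trans hpT) hp.le
  have hdom : ∀ k ∈ insert i₀ J, 1 < ε * θ k * (ε * tTransform μ z) := fun k hk => by
    have hle : ε * θ i₀ ≤ ε * θ k := by
      rcases Finset.mem_insert.1 hk with rfl | hk
      exacts [le_rfl, hJ.2.1 k hk]
    exact hpT.trans_le (mul_le_mul_of_nonneg_right hle hτ.le)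
  filter_upwards [(h.gramTendsto_sqrt_div hμ ha0 hε hz).eventually_exists_submodule hτ hdom,
    h.eventually_mul_sub_pos hz, eventually_ge_atTop r] with n hW hN hr
  obtain ⟨W, hWcard, hW⟩ := hW
  obtain ⟨hanti, f, hf⟩ := exists_eigenbasis_perturbed (hx n) (hX n) (hP n hr)
  obtain ⟨j, s, hs, hj, hrank⟩ := hrank hr hanti
  obtain ⟨A, hA⟩ := exists_resolvent_substitution (e n) (hx n) hN (v n) θ
  rw [hj]
  refine hrank.le_of_form_ge (e := f) (W.map A.toLinearMap) ?_ ?_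
  · rw [LinearEquiv.finrank_map_eq, hWcard, Finset.card_insert_of_notMem hJ.1, hs]
    exact Nat.lt_succ_self _
  · rintro _ ⟨y, hy, rfl⟩
    simp only [mul_assoc ε (orderedEigenvalue _ _), ← Finset.mul_sum, hf, LinearEquiv.coe_coe]
    linarith [hA y, hW y hy]

theorem eventually_outlier_le_mul (i₀ : Fin r) (hε : ε = 1 ∨ ε = -1) (hp : 0 < ε * θ i₀) {z : ℝ}
    (hz : ∀ t ∈ Set.Icc a b, 0 < ε * (z - t)) (hT : tTransform μ z * θ i₀ < 1) :
    ∀ᶠ n in atTop, ε * outlierEigenvalue (X n) (P n) θ i₀ ≤ ε * z := by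
  obtain ⟨J, hJ, hrank⟩ := exists_isRankedBefore_outlier (𝕜 := 𝕜) hθ i₀ hε hp
  have hpT : ε * tTransform μ z < (ε * θ i₀)⁻¹ := by
    rw [← one_div, lt_div_iff₀ hp]
    rcases hε with rfl | rfl <;> linarith
  filter_upwards [(h.gramTendsto_sqrt_div hμ ha0 hε hz).eventually_sum_sq_norm_inner_le
    (inv_nonneg.2 hp.le) hpT, h.eventually_mul_sub_pos hz, eventually_ge_atTop r]
    with n hG hN hr
  obtain ⟨hanti, f, hf⟩ := exists_eigenbasis_perturbed (hx n) (hX n) (hP n hr)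
  obtain ⟨j, s, hs, hj, hrank⟩ := hrank hr hanti
  obtain ⟨A, hA⟩ := exists_resolvent_substitution (e n) (hx n) hN (v n) θ
  set g := fun k =>
    frameOp (𝕜 := 𝕜) (e n) (fun i => √(x n i / (ε * (z - x n i)))) (v n k)
  have hforms : ∀ y ∈ (Submodule.span 𝕜 (J.image g : Set (EuclideanSpace 𝕜 (Fin n))))ᗮ,
      ∑ k, ε * θ k * ‖⟪g k, y⟫_𝕜‖ ^ 2 ≤ ‖y‖ ^ 2 := fun y hy => calc
    ∑ k, ε * θ k * ‖⟪g k, y⟫_𝕜‖ ^ 2 ≤ ∑ k, ε * θ i₀ * ‖⟪g k, y⟫_𝕜‖ ^ 2 := by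
      refine Finset.sum_le_sum fun k _ => ?_
      by_cases hk : k ∈ J
      · rw [hy (g k) (Submodule.subset_span (Finset.mem_image_of_mem g hk))]
        simp
      · exact mul_le_mul_of_nonneg_right (hJ.2.2 k hk) (sq_nonneg _)
    _ = ε * θ i₀ * ∑ k, ‖⟪g k, y⟫_𝕜‖ ^ 2 := by rw [Finset.mul_sum]
    _ ≤ ε * θ i₀ * ((ε * θ i₀)⁻¹ * ‖y‖ ^ 2) := mul_le_mul_of_nonneg_left (hG y) hp.le
    _ = ‖y‖ ^ 2 := mul_inv_cancel_left₀ hp.ne' _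
  rw [hj]
  refine hrank.le_of_form_le (e := f) (Submodule.map A.toLinearMap
    (Submodule.span 𝕜 (J.image g : Set (EuclideanSpace 𝕜 (Fin n))))ᗮ) ?_ ?_
  · rw [LinearEquiv.finrank_map_eq, hs, ← Submodule.finrank_add_finrank_orthogonal
      (Submodule.span 𝕜 (J.image g : Set (EuclideanSpace 𝕜 (Fin n)))), add_comm]
    exact Nat.add_le_add_left ((finrank_span_finset_le_card _).trans Finset.card_image_le) _
  · rintro _ ⟨y, hy, rfl⟩
    simp only [mul_assoc ε (orderedEigenvalue _ _), ← Finset.mul_sum, hf, LinearEquiv.coe_coe]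
    linarith [hA y, hforms y hy]

theorem tendsto_outlier (hμ0 : μ ≠ Measure.dirac 0) (i₀ : Fin r) (hθ₀ : θ i₀ ≠ 0) {ρ : ℝ}
    (hρ : ρ ∉ Set.Icc a b) (hTρ : tTransform μ ρ = 1 / θ i₀) :
    Tendsto (fun n => outlierEigenvalue (X n) (P n) θ i₀) atTop (𝓝 ρ) := by
  have hinv : tTransform μ ρ * θ i₀ = 1 := by rw [hTρ, one_div_mul_cancel hθ₀]
  rcases hθ₀.lt_or_gt with hneg | hpos
  · have hanti := strictAntiOn_tTransform_Iio hμ ha0 hμ0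
    have hρa := lt_of_tTransform_neg hμ ha0 hρ (hTρ ▸ one_div_neg.2 hneg)
    refine tendsto_order.2 ⟨fun w hw => ?_, fun w hw => ?_⟩
    · obtain ⟨z, hwz, hzρ⟩ := exists_between hw
      have hT := hanti (hzρ.trans hρa) hρa hzρ
      filter_upwards [h.eventually_outlier_le_mul hμ ha0 hx hX hθ hP i₀ (Or.inr rfl)
        (by linarith) (fun t ht => by linarith [ht.1]) (hinv ▸ mul_lt_mul_of_neg_right hT hneg)]
        with n hn
      linarith
    · obtain ⟨z, hρz, hz⟩ := exists_between (lt_min hw hρa)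
      obtain ⟨hzw, hza⟩ := lt_min_iff.1 hz
      have hT := hanti hρa hza hρz
      filter_upwards [h.eventually_mul_le_outlier hμ ha0 hx hX hθ hP i₀ (Or.inr rfl)
        (by linarith) (fun t ht => by linarith [ht.1]) (hinv ▸ mul_lt_mul_of_neg_right hT hneg)]
        with n hn
      linarith
  · have hanti := strictAntiOn_tTransform_Ioi hμ ha0 hμ0
    have hρb := lt_of_tTransform_pos hμ ha0 hρ (hTρ ▸ one_div_pos.2 hpos)
    refine tendsto_order.2 ⟨fun w hw => ?_, fun w hw => ?_⟩
    · obtain ⟨z, hz, hzρ⟩ := exists_between (max_lt hw hρb)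
      obtain ⟨hwz, hbz⟩ := max_lt_iff.1 hz
      have hT := hanti hbz hρb hzρ
      filter_upwards [h.eventually_mul_le_outlier hμ ha0 hx hX hθ hP i₀ (Or.inl rfl)
        (by linarith) (fun t ht => by linarith [ht.2]) (hinv ▸ mul_lt_mul_of_pos_right hT hpos)]
        with n hn
      linarith
    · obtain ⟨z, hρz, hzw⟩ := exists_between hw
      have hT := hanti hρb (hρb.trans hρz) hρz
      filter_upwards [h.eventually_outlier_le_mul hμ ha0 hx hX hθ hP i₀ (Or.inl rfl)
        (by linarith) (fun t ht => by linarith [ht.2]) (hinv ▸ mul_lt_mul_of_pos_right hT hpos)]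
        with n hn
      linarith

end IsotropicLimit

end Outliers

section Eigenvectors

variable {𝕜 : Type*} [RCLike 𝕜]

theorem tendsto_quadForm_zero {α κ : Type*} [Fintype κ] {L : Filter α} {M : α → κ → κ → 𝕜}
    (hM : ∀ k l, Tendsto (fun a => M a k l) L (𝓝 0)) {c : α → κ → 𝕜} {C : ℝ}
    (hc : ∀ᶠ a in L, ∀ k, ‖c a k‖ ≤ C) :
    Tendsto (fun a => quadForm (M a) (c a)) L (𝓝 0) := by
  have hterm : ∀ k l,
      Tendsto (fun a => (starRingEnd 𝕜) (c a k) * c a l * M a k l) L (𝓝 0) := fun k l => by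
    refine (hM k l).zero_mul_isBoundedUnder_le (g := fun a => (starRingEnd 𝕜) (c a k) * c a l)
      (isBoundedUnder_of_eventually_le (a := C * C) ?_) |>.congr fun a => mul_comm _ _
    filter_upwards [hc] with a ha
    simp only [Function.comp_apply, norm_mul, RCLike.norm_conj]
    exact mul_le_mul (ha k) (ha l) (norm_nonneg _) ((norm_nonneg _).trans (ha k))
  have hsum := tendsto_finsetSum Finset.univ fun k _ =>
    tendsto_finsetSum Finset.univ fun l _ => hterm k l
  simp only [Finset.sum_const_zero] at hsum
  simpa only [map_zero] using! (RCLike.continuous_re.tendsto 0).comp hsum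

theorem GramTendsto.tendsto_norm_sq_sum_sub {α κ : Type*} [Fintype κ] [DecidableEq κ]
    {L : Filter α} {F : α → Type*} [∀ a, NormedAddCommGroup (F a)]
    [∀ a, InnerProductSpace 𝕜 (F a)] {g : ∀ a, κ → F a} {τ : ℝ} (hg : GramTendsto 𝕜 g L τ)
    {c : α → κ → 𝕜} {C : ℝ} (hc : ∀ᶠ a in L, ∀ k, ‖c a k‖ ≤ C) :
    Tendsto (fun a => ‖∑ k, c a k • g a k‖ ^ 2 - τ * ∑ k, ‖c a k‖ ^ 2) L (𝓝 0) := by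
  have hentry : ∀ k l, Tendsto (fun a => ⟪g a k, g a l⟫_𝕜 - if k = l then (τ : 𝕜) else 0) L
      (𝓝 0) := fun k l => by
    simpa only [sub_self] using (hg k l).sub_const (if k = l then (τ : 𝕜) else 0)
  refine (tendsto_quadForm_zero hentry hc).congr fun a => ?_
  have hid := quadForm_inner (g a) LinearMap.id (c a)
  simp only [LinearMap.id_apply] at hid
  rw [quadForm_sub, quadForm_diagonal, hid, inner_self_eq_norm_sq, Finset.mul_sum]

variable {r : ℕ} {θ : Fin r → ℝ}

theorem IsUnitEigenvector.eq_frameOp_apply {n : ℕ} {X P : Matrix (Fin n) (Fin n) 𝕜}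
    {e : OrthonormalBasis (Fin n) 𝕜 (EuclideanSpace 𝕜 (Fin n))} {x : Fin n → ℝ}
    (hX : Matrix.toEuclideanLin X = frameOp e x) {l : ℝ} (hl : ∀ i, l - x i ≠ 0)
    {u : EuclideanSpace 𝕜 (Fin n)} (hu : IsUnitEigenvector (perturbed X P) l u) :
    u = frameOp (𝕜 := 𝕜) e (fun i => x i / (l - x i)) (Matrix.toEuclideanLin P u) := by
  have heig : frameOp (𝕜 := 𝕜) e x u + frameOp (𝕜 := 𝕜) e x (Matrix.toEuclideanLin P u) =
      (l : 𝕜) • u := by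
    rw [← hu.2, perturbed, toEuclideanLin_mul_apply, map_add, LinearMap.add_apply,
      toEuclideanLin_one, hX, map_add, LinearMap.id_apply]
  refine e.repr.injective (PiLp.ext fun i => ?_)
  have hi := congrArg (fun w => ⟪e i, w⟫_𝕜) heig
  simp only [inner_left_frameOp e.orthonormal, inner_add_right, inner_smul_right] at hi
  have hli : (l : 𝕜) - (x i : 𝕜) ≠ 0 := by
    rw [← RCLike.ofReal_sub]
    exact_mod_cast hl i
  rw [e.repr_apply_apply, e.repr_apply_apply, inner_left_frameOp e.orthonormal]
  push_cast
  rw [div_mul_eq_mul_div, eq_div_iff hli]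
  linear_combination -hi

namespace IsotropicLimit

variable {μ : Measure ℝ} {a b : ℝ}
  {e : ∀ n, OrthonormalBasis (Fin n) 𝕜 (EuclideanSpace 𝕜 (Fin n))} {x : ∀ n, Fin n → ℝ}
  {v : ∀ n, Fin r → EuclideanSpace 𝕜 (Fin n)} {X P : ∀ n, Matrix (Fin n) (Fin n) 𝕜}
  {l : ℕ → ℝ} {u : ∀ n, EuclideanSpace 𝕜 (Fin n)} (h : IsotropicLimit μ a b e x v)
  (hu : ∀ n, r ≤ n → IsUnitEigenvector (perturbed (X n) (P n)) (l n) (u n))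
include h hu

theorem eventually_norm_inner_le_one : ∀ᶠ n in atTop, ∀ k, ‖⟪v n k, u n⟫_𝕜‖ ≤ 1 := by
  filter_upwards [h.orthonormal, eventually_ge_atTop r] with n hv hn k
  simpa only [hv.1 k, (hu n hn).1, one_mul] using norm_inner_le_norm (𝕜 := 𝕜) (v n k) (u n)

variable (hX : ∀ n, Matrix.toEuclideanLin (X n) = frameOp (e n) (x n))
  (hP : ∀ n, r ≤ n → Matrix.toEuclideanLin (P n) = frameOp (v n) θ)
  {ρ : ℝ} (hρ : ρ ∉ Set.Icc a b) (hl : Tendsto l atTop (𝓝 ρ))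
include hX hP hρ hl

theorem eventually_eigenvector_eq_sum :
    ∀ᶠ n in atTop, u n = ∑ k, ((θ k : 𝕜) * ⟪v n k, u n⟫_𝕜) •
      frameOp (𝕜 := 𝕜) (e n) (fun i => x n i / (l n - x n i)) (v n k) := by
  have hsep : ∀ᶠ n in atTop, ∀ i, l n - x n i ≠ 0 :=
    h.eventually_forall hl (p := fun z t => z - t ≠ 0) fun t ht =>
      (Continuous.tendsto (by fun_prop) (ρ, t)).eventually_ne (sub_ne_zero_of_notMem_Icc hρ ht)
  filter_upwards [hsep, eventually_ge_atTop r] with n hn hr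
  conv_lhs => rw [(hu n hr).eq_frameOp_apply (hX n) hn, hP n hr, frameOp_apply (v n)]
  simp only [map_sum, map_smul]

variable (hμ : ∀ᵐ t ∂μ, t ∈ Set.Icc a b) [IsProbabilityMeasure μ]
include hμ

/-- The secular equation: the coordinates of the eigenvector are asymptotically fixed by the
diagonal matrix with entries `tTransform μ ρ * θ m`. -/
theorem tendsto_inner_eigenvector (m : Fin r) (hm : tTransform μ ρ * θ m ≠ 1) :
    Tendsto (fun n => ⟪v n m, u n⟫_𝕜) atTop (𝓝 0) := by
  let T : 𝕜 := (tTransform μ ρ : 𝕜)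
  have hG : ∀ k, Tendsto (fun n => ⟪v n m,
      frameOp (𝕜 := 𝕜) (e n) (fun i => x n i / (l n - x n i)) (v n k)⟫_𝕜 -
        if m = k then T else 0) atTop (𝓝 0) := fun k => by
    have hlim := h.tendsto_inner_frameOp hμ (f := fun z t => t / (z - t)) (fun t ht =>
      ContinuousAt.div (by fun_prop) (by fun_prop) (sub_ne_zero_of_notMem_Icc hρ ht)) hl m k
    simpa only [T, tTransform, sub_self] using hlim.sub_const (if m = k then T else 0)
  have hbounded : ∀ k, Tendsto (fun n => (⟪v n m,
      frameOp (𝕜 := 𝕜) (e n) (fun i => x n i / (l n - x n i)) (v n k)⟫_𝕜 -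
        if m = k then T else 0) * ⟪v n k, u n⟫_𝕜) atTop (𝓝 0) := fun k =>
    (hG k).zero_mul_isBoundedUnder_le <| isBoundedUnder_of_eventually_le (a := 1)
      ((h.eventually_norm_inner_le_one hu).mono fun n hn => hn k)
  have hsecular : Tendsto (fun n => (1 - T * θ m) * ⟪v n m, u n⟫_𝕜) atTop (𝓝 0) := by
    have hsum := tendsto_finsetSum Finset.univ fun k _ => (hbounded k).const_mul (θ k : 𝕜)
    simp only [mul_zero, Finset.sum_const_zero] at hsum
    refine hsum.congr' ?_
    filter_upwards [h.eventually_eigenvector_eq_sum hu hX hP hρ hl] with n hn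
    have hinner := congrArg (fun w => ⟪v n m, w⟫_𝕜) hn
    simp only [inner_sum, inner_smul_right] at hinner
    simp only [sub_mul, mul_sub, Finset.sum_sub_distrib, ite_mul, zero_mul, mul_ite, mul_zero,
      Finset.sum_ite_eq, Finset.mem_univ, if_true, one_mul]
    conv_rhs => rw [hinner]
    congr 1
    · exact Finset.sum_congr rfl fun k _ => by ring
    · rw [← hinner]
      ring
  have hm' : 1 - T * (θ m : 𝕜) ≠ 0 := sub_ne_zero.2 (by simp only [T]; exact_mod_cast hm.symm)
  simpa only [inv_mul_cancel_left₀ hm', mul_zero] using hsecular.const_mul (1 - T * (θ m : 𝕜))⁻¹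

theorem tendsto_sum_sq_eigenvector :
    Tendsto (fun n => (∫ t, (t / (ρ - t)) ^ 2 ∂μ) * ∑ k, θ k ^ 2 * ‖⟪v n k, u n⟫_𝕜‖ ^ 2) atTop
      (𝓝 1) := by
  have hgram := h.gramTendsto hμ (f := fun z t => t / (z - t)) (fun t ht =>
    ContinuousAt.div (by fun_prop) (by fun_prop) (sub_ne_zero_of_notMem_Icc hρ ht)) hl
  have hcoeff : ∀ᶠ n in atTop, ∀ k, ‖(θ k : 𝕜) * ⟪v n k, u n⟫_𝕜‖ ≤ ∑ m, |θ m| := by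
    filter_upwards [h.eventually_norm_inner_le_one hu] with n hn k
    rw [norm_mul, RCLike.norm_ofReal]
    exact (mul_le_of_le_one_right (abs_nonneg _) (hn k)).trans
      (Finset.single_le_sum (f := fun m => |θ m|) (fun m _ => abs_nonneg _) (Finset.mem_univ k))
  have hlim := (hgram.tendsto_norm_sq_sum_sub hcoeff).const_sub 1
  rw [sub_zero] at hlim
  refine hlim.congr' ?_
  filter_upwards [h.eventually_eigenvector_eq_sum hu hX hP hρ hl, eventually_ge_atTop r]
    with n hn hr
  simp only [← hn, (hu n hr).1, norm_mul, RCLike.norm_ofReal, mul_pow, sq_abs]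
  ring

variable {t : ℝ} (ht : t ≠ 0) (hT : tTransform μ ρ = 1 / t)
include ht hT

theorem tendsto_norm_sq_inner_eigenvector {k : Fin r} (hk : θ k ≠ t) :
    Tendsto (fun n => ‖⟪v n k, u n⟫_𝕜‖ ^ 2) atTop (𝓝 0) := by
  have hk' : tTransform μ ρ * θ k ≠ 1 := by
    rw [hT, one_div, Ne, inv_mul_eq_one₀ ht]
    exact hk.symm
  simpa using (h.tendsto_inner_eigenvector hu hX hP hρ hl hμ k hk').norm.pow 2

theorem tendsto_projNorm_kerSub :
    Tendsto (fun n => projNorm (u n) (kerSub (P n) t) ^ 2) atTop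
      (𝓝 (-1 / (t ^ 2 * ρ * deriv (tTransform μ) ρ + t))) := by
  let I := ∫ s, (s / (ρ - s)) ^ 2 ∂μ
  have hrest : Tendsto (fun n => ∑ k with θ k ≠ t, θ k ^ 2 * ‖⟪v n k, u n⟫_𝕜‖ ^ 2) atTop
      (𝓝 0) := by
    have hsum := tendsto_finsetSum {k | θ k ≠ t} fun k hk => (h.tendsto_norm_sq_inner_eigenvector
      hu hX hP hρ hl hμ ht hT (Finset.mem_filter.1 hk).2).const_mul (θ k ^ 2)
    simpa only [mul_zero, Finset.sum_const_zero] using hsum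
  have hproj : Tendsto (fun n => I * t ^ 2 * projNorm (u n) (kerSub (P n) t) ^ 2) atTop
      (𝓝 1) := by
    have hdiff := (h.tendsto_sum_sq_eigenvector hu hX hP hρ hl hμ).sub (hrest.const_mul I)
    rw [mul_zero, sub_zero] at hdiff
    refine hdiff.congr' ?_
    filter_upwards [h.orthonormal, eventually_ge_atTop r] with n hv hn
    rw [kerSub_eq_span hv (hP n hn) ht, projNorm, norm_starProjection_span_sq hv, ← mul_sub,
      ← Finset.sum_filter_add_sum_filter_not Finset.univ (fun k => θ k = t), add_sub_cancel_right,
      mul_assoc, Finset.mul_sum (a := t ^ 2)]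
    congr 1
    exact Finset.sum_congr rfl fun k hk => by rw [(Finset.mem_filter.1 hk).2]
  have hI₀ : I * t ^ 2 ≠ 0 := fun h₀ => by
    simp only [h₀, zero_mul] at hproj
    exact zero_ne_one (tendsto_nhds_unique tendsto_const_nhds hproj)
  have hI : t ^ 2 * ρ * deriv (tTransform μ) ρ + t = -(I * t ^ 2) := by
    have hI' : I = _ := integral_sq_div_sub_sq hμ hρ
    rw [hI', hT]
    field_simp
    ring
  rw [hI, neg_div_neg_eq, one_div, ← mul_one (I * t ^ 2)⁻¹]
  exact (hproj.const_mul _).congr fun n => inv_mul_cancel_left₀ hI₀ _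

theorem tendsto_projNorm_iSup_kerSub (hθ : ∀ i, θ i ≠ 0) :
    Tendsto (fun n => projNorm (u n) (⨆ j : {j : Fin r // θ j ≠ t}, kerSub (P n) (θ j))) atTop
      (𝓝 0) := by
  have hsum := (tendsto_finsetSum {k | θ k ≠ t} fun k hk => h.tendsto_norm_sq_inner_eigenvector
    hu hX hP hρ hl hμ ht hT (Finset.mem_filter.1 hk).2).sqrt
  rw [Finset.sum_const_zero, Real.sqrt_zero] at hsum
  refine hsum.congr' ?_
  filter_upwards [h.orthonormal, eventually_ge_atTop r] with n hv hn
  rw [iSup_kerSub_eq_span hv (hP n hn) hθ, ← norm_starProjection_span_sq hv]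
  exact Real.sqrt_sq (norm_nonneg _)

end IsotropicLimit

end Eigenvectors

section ExchangeablePairs

theorem integral_swap_of_involutive {G α : Type*} [MeasurableSpace G] {ν : Measure G} {τ : G → G}
    (hτ : MeasurePreserving τ ν ν) (hinv : Function.Involutive τ) (Q : G → α) (F : α → α → ℝ) :
    ∫ g, F (Q (τ g)) (Q g) ∂ν = ∫ g, F (Q g) (Q (τ g)) ∂ν := by
  have h := MeasurePreserving.integral_comp' (f := .ofInvolutive τ hinv hτ.measurable) hτ
    fun g => F (Q g) (Q (τ g))
  simpa only [MeasurableEquiv.ofInvolutive_apply, hinv _] using h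

variable {G S : Type*} [TopologicalSpace G] [CompactSpace G] [MeasurableSpace G] [BorelSpace G]
  {ν : Measure G} [IsProbabilityMeasure ν]

theorem integrable_of_continuous {f : G → ℝ} (hf : Continuous f) : Integrable f ν :=
  hf.integrable_of_hasCompactSupport (.of_compactSpace f)

variable [Fintype S] {T : S → G → G} (hTc : ∀ s, Continuous (T s))
  (hTν : ∀ s, MeasurePreserving (T s) ν ν) (hTT : ∀ s, Function.Involutive (T s)) {Q : G → ℝ}
  (hQ : Continuous Q) {L : ℝ} (hdrift : ∀ g, ∑ s, (Q g - Q (T s g)) = L * Q g)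
include hTc hTν hTT hQ hdrift

/-- Exchanging `g` and `T s g` antisymmetrizes `φ (Q g) * (Q g - Q (T s g))`. -/
theorem mul_integral_eq_sum_of_drift {φ : ℝ → ℝ} (hφ : Continuous φ) :
    L * ∫ g, φ (Q g) * Q g ∂ν =
      (∑ s, ∫ g, (φ (Q g) - φ (Q (T s g))) * (Q g - Q (T s g)) ∂ν) / 2 := by
  have hinteg : ∀ {F : ℝ → ℝ → ℝ}, Continuous F.uncurry → ∀ s,
      Integrable (fun g => F (Q g) (Q (T s g))) ν := fun hF s =>
    integrable_of_continuous (hF.comp (hQ.prodMk (hQ.comp (hTc s))))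
  have hsymm : ∀ s, ∫ g, φ (Q g) * (Q g - Q (T s g)) ∂ν =
      (∫ g, (φ (Q g) - φ (Q (T s g))) * (Q g - Q (T s g)) ∂ν) / 2 := fun s => by
    have hswap := integral_swap_of_involutive (hTν s) (hTT s) Q fun p q => φ p * (p - q)
    have hadd := integral_add (hinteg (F := fun p q => φ p * (p - q)) (by fun_prop) s)
      (hinteg (F := fun p q => φ q * (q - p)) (by fun_prop) s)
    rw [hswap, ← two_mul] at hadd
    rw [eq_div_iff two_ne_zero, mul_comm, ← hadd]
    exact integral_congr_ae (.of_forall fun g => by ring)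
  simp only [Finset.sum_div, ← hsymm]
  rw [← integral_finsetSum _ fun s _ => hinteg (F := fun p q => φ p * (p - q)) (by fun_prop) s,
    ← integral_const_mul]
  simp only [← Finset.mul_sum, hdrift, mul_left_comm]

variable {D : ℝ} (hvar : ∀ g, ∑ s, (Q g - Q (T s g)) ^ 2 ≤ D)
include hvar

theorem mul_integral_sq_le_of_drift : L * ∫ g, Q g ^ 2 ∂ν ≤ D / 2 := by
  have hinteg : ∀ s, Integrable (fun g => (Q g - Q (T s g)) ^ 2) ν := fun s =>
    integrable_of_continuous ((hQ.sub (hQ.comp (hTc s))).pow 2)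
  have h := mul_integral_eq_sum_of_drift hTc hTν hTT hQ hdrift continuous_id
  simp only [id, ← sq] at h
  rw [h, ← integral_finsetSum _ fun s _ => hinteg s]
  gcongr
  simpa using integral_mono (integrable_finsetSum _ fun s _ => hinteg s) (integrable_const D) hvar

theorem mul_integral_pow_four_le_of_drift :
    L * ∫ g, Q g ^ 4 ∂ν ≤ 3 / 2 * (D * ∫ g, Q g ^ 2 ∂ν) := by
  have hinteg : ∀ {F : ℝ → ℝ → ℝ}, Continuous F.uncurry → ∀ s,
      Integrable (fun g => F (Q g) (Q (T s g))) ν := fun hF s =>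
    integrable_of_continuous (hF.comp (hQ.prodMk (hQ.comp (hTc s))))
  have hincr : ∀ s, ∫ g, (Q g ^ 3 - Q (T s g) ^ 3) * (Q g - Q (T s g)) ∂ν ≤
      3 * ∫ g, Q g ^ 2 * (Q g - Q (T s g)) ^ 2 ∂ν := fun s => by
    have hswap := integral_swap_of_involutive (hTν s) (hTT s) Q fun p q => p ^ 2 * (p - q) ^ 2
    have hinteg₁ := hinteg (F := fun p q => p ^ 2 * (p - q) ^ 2) (by fun_prop) s
    have hinteg₂ := hinteg (F := fun p q => q ^ 2 * (q - p) ^ 2) (by fun_prop) s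
    have hmono := integral_mono
      (hinteg (F := fun p q => (p ^ 3 - q ^ 3) * (p - q)) (by fun_prop) s)
      ((hinteg₁.add hinteg₂).const_mul (3 / 2)) fun g => by
        simp only [Pi.add_apply]
        nlinarith [mul_nonneg (sq_nonneg (Q g - Q (T s g))) (sq_nonneg (Q g - Q (T s g)))]
    rw [integral_const_mul, integral_add' hinteg₁ hinteg₂, hswap] at hmono
    linarith
  have hsum : ∑ s, ∫ g, Q g ^ 2 * (Q g - Q (T s g)) ^ 2 ∂ν ≤ D * ∫ g, Q g ^ 2 ∂ν := by
    have hinteg₁ := hinteg (F := fun p q => p ^ 2 * (p - q) ^ 2) (by fun_prop)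
    rw [← integral_finsetSum _ fun s _ => hinteg₁ s, ← integral_const_mul]
    refine integral_mono (integrable_finsetSum _ fun s _ => hinteg₁ s)
      ((integrable_of_continuous (hQ.pow 2)).const_mul D) fun g => ?_
    simp only [← Finset.mul_sum, mul_comm D]
    exact mul_le_mul_of_nonneg_left (hvar g) (sq_nonneg _)
  have h := mul_integral_eq_sum_of_drift hTc hTν hTT hQ hdrift (continuous_pow 3)
  simp only [← pow_succ] at h
  rw [h]
  have hle := Finset.sum_le_sum fun s (_ : s ∈ Finset.univ) => hincr s
  rw [← Finset.mul_sum] at hle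
  linarith

/-- Stein's method of exchangeable pairs: the increments of `Q` along the involutions `T s` have
drift proportional to `Q` and bounded quadratic variation. -/
theorem integral_pow_four_le_of_drift (hL : 0 < L) :
    ∫ g, Q g ^ 4 ∂ν ≤ 3 * D ^ 2 / (4 * L ^ 2) := by
  have hD : 0 ≤ D := by
    obtain ⟨g⟩ := nonempty_of_isProbabilityMeasure ν
    exact (Finset.sum_nonneg fun s _ => sq_nonneg _).trans (hvar g)
  have h₂ := mul_integral_sq_le_of_drift hTc hTν hTT hQ hdrift hvar
  have h₄ := mul_integral_pow_four_le_of_drift hTc hTν hTT hQ hdrift hvar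
  rw [le_div_iff₀ (by positivity)]
  calc (∫ g, Q g ^ 4 ∂ν) * (4 * L ^ 2) = 4 * L * (L * ∫ g, Q g ^ 4 ∂ν) := by ring
    _ ≤ 4 * L * (3 / 2 * (D * ∫ g, Q g ^ 2 ∂ν)) := by gcongr
    _ = 6 * D * (L * ∫ g, Q g ^ 2 ∂ν) := by ring
    _ ≤ 6 * D * (D / 2) := by gcongr
    _ = 3 * D ^ 2 := by ring

end ExchangeablePairs

section TiltedBasisVectors

variable {𝕜 E ι : Type*} [RCLike 𝕜] [NormedAddCommGroup E] [InnerProductSpace 𝕜 E]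

theorem re_inner_apply_comm {B : E →ₗ[𝕜] E} (hB : B.IsSymmetric) (y z : E) :
    RCLike.re ⟪y, B z⟫_𝕜 = RCLike.re ⟪z, B y⟫_𝕜 := by
  rw [← hB, inner_re_symm]

theorem re_inner_apply_smul_add_smul {B : E →ₗ[𝕜] E} (hB : B.IsSymmetric) (c s : ℝ) (y z : E) :
    RCLike.re ⟪(c : 𝕜) • y + (s : 𝕜) • z, B ((c : 𝕜) • y + (s : 𝕜) • z)⟫_𝕜 =
      c ^ 2 * RCLike.re ⟪y, B y⟫_𝕜 + s ^ 2 * RCLike.re ⟪z, B z⟫_𝕜 +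
        2 * c * s * RCLike.re ⟪y, B z⟫_𝕜 := by
  simp only [map_add, map_smul, inner_add_left, inner_add_right, inner_smul_left, inner_smul_right,
    RCLike.conj_ofReal, RCLike.re_ofReal_mul, re_inner_apply_comm hB z y]
  ring

variable [Fintype ι] (b : OrthonormalBasis ι 𝕜 E) (i₀ : ι) {c s : ℝ}

/-- The vectors `c • b i₀ ± s • b j` for `j ≠ i₀`, the sign being encoded by a Boolean. For
`c ^ 2 + s ^ 2 = 1` they are the unit vectors obtained from `b i₀` by tilting it towards the other
basis vectors. -/
def tilt (c s : ℝ) (p : {j // j ≠ i₀} × Bool) : E :=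
  (c : 𝕜) • b i₀ + ((cond p.2 s (-s) : ℝ) : 𝕜) • b p.1

theorem inner_tilt (c s : ℝ) (p : {j // j ≠ i₀} × Bool) : ⟪b i₀, tilt b i₀ c s p⟫_𝕜 = c := by
  simp [tilt, inner_add_right, inner_smul_right, b.inner_eq_zero p.1.2.symm]

theorem norm_tilt (hcs : c ^ 2 + s ^ 2 = 1) (p : {j // j ≠ i₀} × Bool) :
    ‖tilt b i₀ c s p‖ = 1 := by
  have h := norm_add_sq_eq_norm_sq_add_norm_sq_of_inner_eq_zero (𝕜 := 𝕜) ((c : 𝕜) • b i₀)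
    (((cond p.2 s (-s) : ℝ) : 𝕜) • b p.1)
    (by rw [inner_smul_left, inner_smul_right, b.inner_eq_zero p.1.2.symm, mul_zero, mul_zero])
  rw [← sq_eq_sq₀ (norm_nonneg _) zero_le_one, one_pow, ← hcs, sq, tilt, h, ← sq, ← sq]
  rcases p with ⟨j, _ | _⟩ <;> simp [norm_smul]

variable {B : E →ₗ[𝕜] E} (hB : B.IsSymmetric)
include hB

theorem re_inner_apply_sub_tilt (hcs : c ^ 2 + s ^ 2 = 1) (p : {j // j ≠ i₀} × Bool) :
    RCLike.re ⟪b i₀, B (b i₀)⟫_𝕜 - RCLike.re ⟪tilt b i₀ c s p, B (tilt b i₀ c s p)⟫_𝕜 =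
      s ^ 2 * (RCLike.re ⟪b i₀, B (b i₀)⟫_𝕜 - RCLike.re ⟪b p.1, B (b p.1)⟫_𝕜) -
        2 * c * cond p.2 s (-s) * RCLike.re ⟪b i₀, B (b p.1)⟫_𝕜 := by
  rw [tilt, re_inner_apply_smul_add_smul hB, eq_sub_of_add_eq hcs]
  rcases p with ⟨j, _ | _⟩ <;> simp only [cond_false, cond_true] <;> ring

theorem sum_sq_re_inner_apply_le {K : ℝ} (hK : ∀ y, ‖B y‖ ≤ K * ‖y‖) :
    ∑ j, RCLike.re ⟪b i₀, B (b j)⟫_𝕜 ^ 2 ≤ K ^ 2 := by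
  have h := hK (b i₀)
  rw [b.norm_eq_one, mul_one] at h
  calc _ ≤ ∑ j, ‖⟪B (b i₀), b j⟫_𝕜‖ ^ 2 := Finset.sum_le_sum fun j _ => by
        rw [hB, ← sq_abs]
        exact pow_le_pow_left₀ (abs_nonneg _) (RCLike.abs_re_le_norm _) 2
    _ = ‖B (b i₀)‖ ^ 2 := b.sum_sq_norm_inner_left _
    _ ≤ K ^ 2 := pow_le_pow_left₀ (norm_nonneg _) h 2

variable [DecidableEq ι]

theorem sum_re_inner_apply_sub_tilt (hcs : c ^ 2 + s ^ 2 = 1)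
    (htr : ∑ i, RCLike.re ⟪b i, B (b i)⟫_𝕜 = 0) :
    ∑ p, (RCLike.re ⟪b i₀, B (b i₀)⟫_𝕜 - RCLike.re ⟪tilt b i₀ c s p, B (tilt b i₀ c s p)⟫_𝕜) =
      2 * Fintype.card ι * s ^ 2 * RCLike.re ⟪b i₀, B (b i₀)⟫_𝕜 := by
  set d := fun i => RCLike.re ⟪b i, B (b i)⟫_𝕜
  have hd : ∑ j : {j // j ≠ i₀}, (d i₀ - d j) = Fintype.card ι * d i₀ := by
    have h := Fintype.sum_eq_add_sum_subtype_ne (fun j => d i₀ - d j) i₀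
    rw [Finset.sum_sub_distrib, htr, sub_self, zero_add, sub_zero] at h
    rw [← h, Finset.sum_const, Finset.card_univ, nsmul_eq_mul]
  calc _ = ∑ j : {j // j ≠ i₀}, 2 * s ^ 2 * (d i₀ - d j) := by
        simp only [re_inner_apply_sub_tilt b i₀ hB hcs, Fintype.sum_prod_type, Fintype.sum_bool,
          cond_true, cond_false]
        exact Finset.sum_congr rfl fun j _ => by ring
    _ = _ := by rw [← Finset.mul_sum, hd]; ring

theorem sum_sq_re_inner_apply_sub_tilt_le {K : ℝ} (hK : ∀ y, ‖B y‖ ≤ K * ‖y‖)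
    (hcs : c ^ 2 + s ^ 2 = 1) :
    ∑ p, (RCLike.re ⟪b i₀, B (b i₀)⟫_𝕜 - RCLike.re ⟪tilt b i₀ c s p, B (tilt b i₀ c s p)⟫_𝕜) ^ 2 ≤
      8 * K ^ 2 * (Fintype.card ι * s ^ 4 + s ^ 2) := by
  set d := fun i => RCLike.re ⟪b i, B (b i)⟫_𝕜
  set f := fun j => RCLike.re ⟪b i₀, B (b j)⟫_𝕜
  have hd : ∀ i, |d i| ≤ K := fun i => by
    have h := (norm_inner_le_norm (𝕜 := 𝕜) (b i) (B (b i))).trans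
      (mul_le_mul_of_nonneg_left (hK (b i)) (norm_nonneg _))
    rw [b.norm_eq_one, one_mul, mul_one] at h
    exact (RCLike.abs_re_le_norm _).trans h
  have hj : ∀ j, 2 * (s ^ 4 * (d i₀ - d j) ^ 2) + 8 * (c ^ 2 * (s ^ 2 * f j ^ 2)) ≤
      8 * K ^ 2 * s ^ 4 + 8 * s ^ 2 * f j ^ 2 := fun j => by
    have hdj : (d i₀ - d j) ^ 2 ≤ (K + K) ^ 2 :=
      sq_le_sq.2 (((abs_sub _ _).trans (add_le_add (hd i₀) (hd j))).trans (le_abs_self _))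
    have hc : c ^ 2 ≤ 1 := hcs ▸ le_add_of_nonneg_right (sq_nonneg s)
    have h₁ : s ^ 4 * (d i₀ - d j) ^ 2 ≤ s ^ 4 * (K + K) ^ 2 := by gcongr
    have h₂ : c ^ 2 * (s ^ 2 * f j ^ 2) ≤ 1 * (s ^ 2 * f j ^ 2) := by gcongr
    linarith
  calc _ = ∑ j : {j // j ≠ i₀},
          (2 * (s ^ 4 * (d i₀ - d j) ^ 2) + 8 * (c ^ 2 * (s ^ 2 * f j ^ 2))) := by
        simp only [re_inner_apply_sub_tilt b i₀ hB hcs, Fintype.sum_prod_type, Fintype.sum_bool,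
          cond_true, cond_false]
        exact Finset.sum_congr rfl fun j _ => by ring
    _ ≤ ∑ j, (2 * (s ^ 4 * (d i₀ - d j) ^ 2) + 8 * (c ^ 2 * (s ^ 2 * f j ^ 2))) := by
        rw [Fintype.sum_eq_add_sum_subtype_ne _ i₀]
        exact le_add_of_nonneg_left (by positivity)
    _ ≤ ∑ j, (8 * K ^ 2 * s ^ 4 + 8 * s ^ 2 * f j ^ 2) := Finset.sum_le_sum fun j _ => hj j
    _ = 8 * K ^ 2 * (Fintype.card ι * s ^ 4) + 8 * s ^ 2 * ∑ j, f j ^ 2 := by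
        rw [Finset.sum_add_distrib, ← Finset.mul_sum _ _ (8 * s ^ 2), Finset.sum_const,
          Finset.card_univ, nsmul_eq_mul]
        ring
    _ ≤ 8 * K ^ 2 * (Fintype.card ι * s ^ 4) + 8 * s ^ 2 * K ^ 2 := by
        gcongr
        exact sum_sq_re_inner_apply_le b i₀ hB hK
    _ = _ := by ring

end TiltedBasisVectors

section UnitaryGroup

variable {𝕜 : Type*} [RCLike 𝕜] {n : ℕ}

theorem reflection_apply_eq_of_inner_comm {E : Type*} [NormedAddCommGroup E]
    [InnerProductSpace 𝕜 E] {y z : E} (hyz : ‖y‖ = ‖z‖) (h : ⟪y, z⟫_𝕜 = ⟪z, y⟫_𝕜) :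
    (𝕜 ∙ (y - z))ᗮ.reflection y = z := by
  have hsub := Submodule.reflection_orthogonalComplement_singleton_eq_neg (𝕜 := 𝕜) (y - z)
  have hadd : (𝕜 ∙ (y - z))ᗮ.reflection (y + z) = y + z := by
    refine Submodule.reflection_mem_subspace_eq_self ?_
    simp only [Submodule.mem_orthogonal_singleton_iff_inner_left, inner_add_left, inner_sub_right,
      inner_self_eq_norm_sq_to_K, hyz, h]
    ring
  have h2 := congrArg₂ (· + ·) hadd hsub
  rw [← map_add, neg_sub, add_add_sub_cancel, add_comm y z, add_add_sub_cancel, ← two_smul 𝕜 y,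
    ← two_smul 𝕜 z, map_smul] at h2
  exact smul_right_injective _ two_ne_zero h2

theorem exists_unitary_toEuclideanLin_eq
    {f : EuclideanSpace 𝕜 (Fin n) →ₗ[𝕜] EuclideanSpace 𝕜 (Fin n)} (hf : f.IsSymmetric)
    (hff : Function.Involutive f) :
    ∃ R : Matrix.unitaryGroup (Fin n) 𝕜, star R = R ∧
      Matrix.toEuclideanLin (R : Matrix (Fin n) (Fin n) 𝕜) = f := by
  obtain ⟨R, rfl⟩ := Matrix.toEuclideanLin.surjective f
  have hR : star R = R := Matrix.isSymmetric_toEuclideanLin_iff.1 hf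
  have hRR : R * R = 1 := Matrix.toEuclideanLin.injective <| LinearMap.ext fun y => by
    rw [toEuclideanLin_mul_apply, hff, toEuclideanLin_one, LinearMap.id_apply]
  exact ⟨⟨R, Matrix.mem_unitaryGroup_iff.2 (by rw [hR, hRR])⟩, Subtype.ext hR, rfl⟩

theorem exists_unitary_involution {y z : EuclideanSpace 𝕜 (Fin n)} (hyz : ‖y‖ = ‖z‖)
    (h : ⟪y, z⟫_𝕜 = ⟪z, y⟫_𝕜) :
    ∃ R : Matrix.unitaryGroup (Fin n) 𝕜, star R = R ∧
      Matrix.toEuclideanLin (R : Matrix (Fin n) (Fin n) 𝕜) y = z := by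
  let F := (𝕜 ∙ (y - z))ᗮ.reflection
  obtain ⟨R, hR, hRF⟩ := exists_unitary_toEuclideanLin_eq (f := F.toLinearEquiv.toLinearMap)
    (fun u v => by
      have h := F.inner_map_map u (F v)
      rwa [Submodule.reflection_reflection] at h)
    (Submodule.reflection_reflection _)
  exact ⟨R, hR, by rw [hRF]; exact reflection_apply_eq_of_inner_comm hyz h⟩

instance matrixBorelSpace : BorelSpace (Matrix (Fin n) (Fin n) 𝕜) :=
  inferInstanceAs (BorelSpace (Fin n → Fin n → 𝕜))

instance matrixSecondCountable : SecondCountableTopology (Matrix (Fin n) (Fin n) 𝕜) :=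
  inferInstanceAs (SecondCountableTopology (Fin n → Fin n → 𝕜))

instance unitaryGroupCompactSpace : CompactSpace (Matrix.unitaryGroup (Fin n) 𝕜) := by
  have hbox : IsCompact (Set.univ.pi fun _ => Set.univ.pi fun _ => Metric.closedBall 0 1 :
      Set (Fin n → Fin n → 𝕜)) :=
    isCompact_univ_pi fun _ => isCompact_univ_pi fun _ => isCompact_closedBall 0 1
  refine isCompact_iff_compactSpace.1 <| hbox.of_isClosed_subset
    (isClosed_unitary (R := Matrix (Fin n) (Fin n) 𝕜)) fun U hU i _ j _ => ?_
  exact mem_closedBall_zero_iff.2 (entry_norm_bound_of_unitary hU i j)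

/-- The Haar probability measure of the unitary group over `𝕜`, which is the orthogonal group when
`𝕜 = ℝ`. -/
def unitaryHaar (𝕜 : Type*) [RCLike 𝕜] (n : ℕ) : Measure (Matrix.unitaryGroup (Fin n) 𝕜) :=
  Measure.haarMeasure ⊤

instance unitaryHaar.isProbabilityMeasure : IsProbabilityMeasure (unitaryHaar 𝕜 n) :=
  ⟨Measure.haarMeasure_self (K₀ := ⊤)⟩

instance unitaryHaar.isMulLeftInvariant : (unitaryHaar 𝕜 n).IsMulLeftInvariant :=
  Measure.isMulLeftInvariant_haarMeasure ⊤

end UnitaryGroup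

open Unitary (conjStarAlgAut)

open scoped Matrix.Norms.L2Operator

section HaarMoments

variable {𝕜 : Type*} [RCLike 𝕜] {n r : ℕ} {A : Matrix (Fin n) (Fin n) 𝕜}

theorem norm_toEuclideanLin_apply_le (A : Matrix (Fin n) (Fin n) 𝕜)
    (y : EuclideanSpace 𝕜 (Fin n)) : ‖Matrix.toEuclideanLin A y‖ ≤ ‖A‖ * ‖y‖ :=
  Matrix.l2_opNorm_mulVec A y

theorem continuous_inner_toEuclideanLin (y z : EuclideanSpace 𝕜 (Fin n)) :
    Continuous fun A : Matrix (Fin n) (Fin n) 𝕜 => ⟪y, Matrix.toEuclideanLin A z⟫_𝕜 :=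
  continuous_const.inner
    ((Matrix.toEuclideanLin.toLinearMap.flip z).continuous_of_finiteDimensional)

theorem sum_inner_toEuclideanLin (A : Matrix (Fin n) (Fin n) 𝕜)
    (b : OrthonormalBasis (Fin n) 𝕜 (EuclideanSpace 𝕜 (Fin n))) :
    ∑ i, ⟪b i, Matrix.toEuclideanLin A (b i)⟫_𝕜 = A.trace := by
  rw [← LinearMap.trace_eq_sum_inner,
    LinearMap.trace_eq_sum_inner _ (EuclideanSpace.basisFun (Fin n) 𝕜)]
  exact Finset.sum_congr rfl fun i _ => by
    simp [EuclideanSpace.inner_single_left, Matrix.toLpLin_apply, Matrix.col_apply]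

/-- The operator `U A U*` on `𝕜ⁿ`, as a function of the unitary matrix `U`. -/
def conjLin (A : Matrix (Fin n) (Fin n) 𝕜) (U : Matrix.unitaryGroup (Fin n) 𝕜) :
    EuclideanSpace 𝕜 (Fin n) →ₗ[𝕜] EuclideanSpace 𝕜 (Fin n) :=
  Matrix.toEuclideanLin (conjStarAlgAut 𝕜 (Matrix (Fin n) (Fin n) 𝕜) U A)

theorem isHermitian_conjStarAlgAut (hA : A.IsHermitian) (U : Matrix.unitaryGroup (Fin n) 𝕜) :
    (conjStarAlgAut 𝕜 (Matrix (Fin n) (Fin n) 𝕜) U A).IsHermitian :=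
  IsSelfAdjoint.map hA (conjStarAlgAut 𝕜 (Matrix (Fin n) (Fin n) 𝕜) U)

theorem trace_conjStarAlgAut (U : Matrix.unitaryGroup (Fin n) 𝕜) (A : Matrix (Fin n) (Fin n) 𝕜) :
    (conjStarAlgAut 𝕜 (Matrix (Fin n) (Fin n) 𝕜) U A).trace = A.trace := by
  rw [Unitary.conjStarAlgAut_apply, Matrix.trace_mul_cycle, Unitary.coe_star_mul_self, one_mul]

theorem norm_conjStarAlgAut (U : Matrix.unitaryGroup (Fin n) 𝕜) (A : Matrix (Fin n) (Fin n) 𝕜) :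
    ‖conjStarAlgAut 𝕜 (Matrix (Fin n) (Fin n) 𝕜) U A‖ = ‖A‖ := by
  rw [Unitary.conjStarAlgAut_apply, ← Unitary.coe_star, CStarRing.norm_mul_coe_unitary,
    CStarRing.norm_coe_unitary_mul]

theorem continuous_conjStarAlgAut (A : Matrix (Fin n) (Fin n) 𝕜) :
    Continuous fun U : Matrix.unitaryGroup (Fin n) 𝕜 =>
      conjStarAlgAut 𝕜 (Matrix (Fin n) (Fin n) 𝕜) U A := by
  simp only [Unitary.conjStarAlgAut_apply]
  fun_prop

theorem isSymmetric_conjLin (hA : A.IsHermitian) (U : Matrix.unitaryGroup (Fin n) 𝕜) :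
    (conjLin A U).IsSymmetric :=
  Matrix.isSymmetric_toEuclideanLin_iff.2 (isHermitian_conjStarAlgAut hA U)

theorem norm_conjLin_apply_le (U : Matrix.unitaryGroup (Fin n) 𝕜)
    (y : EuclideanSpace 𝕜 (Fin n)) : ‖conjLin A U y‖ ≤ ‖A‖ * ‖y‖ :=
  norm_conjStarAlgAut U A ▸ norm_toEuclideanLin_apply_le _ y

theorem continuous_inner_conjLin (A : Matrix (Fin n) (Fin n) 𝕜) (y z : EuclideanSpace 𝕜 (Fin n)) :
    Continuous fun U => ⟪y, conjLin A U z⟫_𝕜 :=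
  (continuous_inner_toEuclideanLin y z).comp (continuous_conjStarAlgAut A)

theorem inner_conjLin_mul {R : Matrix.unitaryGroup (Fin n) 𝕜} (hR : star R = R)
    (U : Matrix.unitaryGroup (Fin n) 𝕜) (y z : EuclideanSpace 𝕜 (Fin n)) :
    ⟪y, conjLin A (R * U) z⟫_𝕜 =
      ⟪Matrix.toEuclideanLin (R : Matrix (Fin n) (Fin n) 𝕜) y,
        conjLin A U (Matrix.toEuclideanLin (R : Matrix (Fin n) (Fin n) 𝕜) z)⟫_𝕜 := by
  have hRs := Matrix.isSymmetric_toEuclideanLin_iff.2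
    (show (R : Matrix (Fin n) (Fin n) 𝕜).IsHermitian from congrArg Subtype.val hR)
  rw [conjLin, Unitary.conjStarAlgAut_mul_apply, Unitary.conjStarAlgAut_apply R,
    ← Unitary.coe_star, hR, toEuclideanLin_mul_apply, toEuclideanLin_mul_apply, hRs]
  rfl

theorem exists_orthonormalBasis_apply_eq {w : EuclideanSpace 𝕜 (Fin n)} (hw : ‖w‖ = 1) :
    ∃ (b : OrthonormalBasis (Fin n) 𝕜 (EuclideanSpace 𝕜 (Fin n))) (i₀ : Fin n), b i₀ = w := by
  obtain ⟨i₀⟩ : Nonempty (Fin n) := by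
    by_contra h
    have := not_nonempty_iff.1 h
    simp [Subsingleton.elim w 0] at hw
  obtain ⟨b, hb⟩ := Orthonormal.exists_orthonormalBasis_extension_of_card_eq (𝕜 := 𝕜)
    (E := EuclideanSpace 𝕜 (Fin n)) (ι := Fin n) (by simp) (v := fun _ => w) (s := {i₀})
    ⟨fun _ => hw, fun i j hij => absurd (Subsingleton.elim i j) hij⟩
  exact ⟨b, i₀, hb i₀ rfl⟩

theorem integral_re_inner_conjLin_self_pow_four_le_of_norm_eq_one (hA : A.IsHermitian)
    (htr : A.trace = 0) {w : EuclideanSpace 𝕜 (Fin n)} (hw : ‖w‖ = 1) :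
    ∫ U, RCLike.re ⟪w, conjLin A U w⟫_𝕜 ^ 4 ∂unitaryHaar 𝕜 n ≤ 48 * ‖A‖ ^ 4 / n ^ 2 := by
  obtain ⟨b, i₀, rfl⟩ := exists_orthonormalBasis_apply_eq hw
  have hn : (1 : ℝ) ≤ n := by exact_mod_cast i₀.pos
  have hn₀ : (n : ℝ) ≠ 0 := (one_pos.trans_le hn).ne'
  have hs : √(1 / n : ℝ) ^ 2 = 1 / n := Real.sq_sqrt (by positivity)
  have hcs : √(1 - 1 / n : ℝ) ^ 2 + √(1 / n : ℝ) ^ 2 = 1 := by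
    rw [hs, Real.sq_sqrt (sub_nonneg.2 (div_le_one_of_le₀ hn (by positivity))), sub_add_cancel]
  have hrefl := fun p => exists_unitary_involution (hw.trans (norm_tilt b i₀ hcs p).symm)
    (by rw [← inner_conj_symm (tilt _ _ _ _ _), inner_tilt, RCLike.conj_ofReal])
  choose R hR hRb using hrefl
  have htr' : ∀ U, ∑ i, RCLike.re ⟪b i, conjLin A U (b i)⟫_𝕜 = 0 := fun U => by
    rw [← map_sum, conjLin, sum_inner_toEuclideanLin, trace_conjStarAlgAut, htr, map_zero]
  have h := integral_pow_four_le_of_drift (T := fun p U => R p * U) (L := 2)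
    (D := 16 * ‖A‖ ^ 2 / n) (Q := fun U => RCLike.re ⟪b i₀, conjLin A U (b i₀)⟫_𝕜)
    (fun p => continuous_const_mul _) (fun p => measurePreserving_mul_left (unitaryHaar 𝕜 n) (R p))
    (fun p U => by
      have h := Unitary.star_mul_self (R p)
      rw [hR p] at h
      simp only [← mul_assoc, h, one_mul])
    (RCLike.continuous_re.comp (continuous_inner_conjLin A _ _))
    (fun U => by
      simp only [inner_conjLin_mul (hR _), hRb]
      rw [sum_re_inner_apply_sub_tilt b i₀ (isSymmetric_conjLin hA U) hcs (htr' U), hs,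
        Fintype.card_fin]
      field_simp)
    (fun U => by
      simp only [inner_conjLin_mul (hR _), hRb]
      refine (sum_sq_re_inner_apply_sub_tilt_le b i₀ (isSymmetric_conjLin hA U)
        (norm_conjLin_apply_le U) hcs).trans_eq ?_
      rw [show √(1 / n : ℝ) ^ 4 = (√(1 / n : ℝ) ^ 2) ^ 2 by ring, hs, Fintype.card_fin]
      field_simp
      ring) two_pos
  refine h.trans_eq ?_
  ring

theorem integral_re_inner_conjLin_self_pow_four_le (hA : A.IsHermitian) (htr : A.trace = 0)
    (w : EuclideanSpace 𝕜 (Fin n)) :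
    ∫ U, RCLike.re ⟪w, conjLin A U w⟫_𝕜 ^ 4 ∂unitaryHaar 𝕜 n ≤
      48 * ‖A‖ ^ 4 / n ^ 2 * ‖w‖ ^ 8 := by
  obtain rfl | hw := eq_or_ne w 0
  · simp
  have h := integral_re_inner_conjLin_self_pow_four_le_of_norm_eq_one hA htr
    (norm_smul_inv_norm (𝕜 := 𝕜) hw)
  have hscale : ∀ U, RCLike.re ⟪w, conjLin A U w⟫_𝕜 ^ 4 = ‖w‖ ^ 8 *
      RCLike.re ⟪((‖w‖⁻¹ : ℝ) : 𝕜) • w, conjLin A U (((‖w‖⁻¹ : ℝ) : 𝕜) • w)⟫_𝕜 ^ 4 := fun U => by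
    rw [map_smul, inner_smul_left, inner_smul_right, RCLike.conj_ofReal, RCLike.re_ofReal_mul,
      RCLike.re_ofReal_mul]
    field_simp [norm_ne_zero_iff.2 hw]
  simp only [hscale, integral_const_mul, mul_comm _ (‖w‖ ^ 8)]
  gcongr
  simpa using h

theorem integral_re_inner_conjLin_pow_four_le (hA : A.IsHermitian) (htr : A.trace = 0)
    {y z : EuclideanSpace 𝕜 (Fin n)} (hy : ‖y‖ ≤ 1) (hz : ‖z‖ ≤ 1) :
    ∫ U, RCLike.re ⟪y, conjLin A U z⟫_𝕜 ^ 4 ∂unitaryHaar 𝕜 n ≤ 768 * ‖A‖ ^ 4 / n ^ 2 := by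
  set q := fun U w => RCLike.re ⟪w, conjLin A U w⟫_𝕜
  have hpolar : ∀ U, RCLike.re ⟪y, conjLin A U z⟫_𝕜 = (q U (y + z) - q U (y - z)) / 4 := fun U => by
    have hsymm := re_inner_apply_comm (isSymmetric_conjLin hA U) z y
    simp only [q, map_add, map_sub, inner_add_left, inner_add_right, inner_sub_left,
      inner_sub_right, hsymm]
    ring
  have hinteg : ∀ w, Integrable (fun U => q U w ^ 4) (unitaryHaar 𝕜 n) := fun w =>
    integrable_of_continuous ((RCLike.continuous_re.comp (continuous_inner_conjLin A w w)).pow 4)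
  have hmom : ∀ {w}, ‖w‖ ≤ 2 → ∫ U, q U w ^ 4 ∂unitaryHaar 𝕜 n ≤
      48 * ‖A‖ ^ 4 / n ^ 2 * 2 ^ 8 := fun hw =>
    (integral_re_inner_conjLin_self_pow_four_le hA htr _).trans (by gcongr)
  have hadd := hmom ((norm_add_le y z).trans (by linarith))
  have hsub := hmom ((norm_sub_le y z).trans (by linarith))
  calc _ ≤ ∫ U, 1 / 32 * (q U (y + z) ^ 4 + q U (y - z) ^ 4) ∂unitaryHaar 𝕜 n := by
        refine integral_mono (integrable_of_continuous
          ((RCLike.continuous_re.comp (continuous_inner_conjLin A y z)).pow 4))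
          (((hinteg _).add (hinteg _)).const_mul _) fun U => ?_
        have h4 : Even 4 := by decide
        have h := h4.add_pow_le (a := q U (y + z)) (b := -q U (y - z))
        rw [← sub_eq_add_neg, h4.neg_pow] at h
        simp only [hpolar, div_pow, Nat.reduceSub] at h ⊢
        linarith
    _ = 1 / 32 * (∫ U, q U (y + z) ^ 4 ∂unitaryHaar 𝕜 n +
          ∫ U, q U (y - z) ^ 4 ∂unitaryHaar 𝕜 n) := by
        rw [integral_const_mul, integral_add (hinteg _) (hinteg _)]
    _ ≤ 1 / 32 * (48 * ‖A‖ ^ 4 / n ^ 2 * 2 ^ 8 + 48 * ‖A‖ ^ 4 / n ^ 2 * 2 ^ 8) := by gcongr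
    _ = 768 * ‖A‖ ^ 4 / n ^ 2 := by ring

theorem integral_norm_inner_conjLin_pow_four_le (hA : A.IsHermitian) (htr : A.trace = 0)
    {y z : EuclideanSpace 𝕜 (Fin n)} (hy : ‖y‖ ≤ 1) (hz : ‖z‖ ≤ 1) :
    ∫ U, ‖⟪y, conjLin A U z⟫_𝕜‖ ^ 4 ∂unitaryHaar 𝕜 n ≤ 3072 * ‖A‖ ^ 4 / n ^ 2 := by
  have hIz : ‖(RCLike.I : 𝕜) • z‖ ≤ 1 := by
    rw [norm_smul]
    refine mul_le_one₀ ?_ (norm_nonneg _) hz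
    obtain hI | hI := eq_or_ne (RCLike.I : 𝕜) 0
    · simp [hI]
    · exact (RCLike.norm_I_of_ne_zero hI).le
  have hre := integral_re_inner_conjLin_pow_four_le hA htr hy hz
  have him := integral_re_inner_conjLin_pow_four_le hA htr hy hIz
  have hinteg : ∀ z, Integrable (fun U => RCLike.re ⟪y, conjLin A U z⟫_𝕜 ^ 4) (unitaryHaar 𝕜 n) :=
    fun z => integrable_of_continuous
      ((RCLike.continuous_re.comp (continuous_inner_conjLin A y z)).pow 4)
  calc _ ≤ ∫ U, 2 * (RCLike.re ⟪y, conjLin A U z⟫_𝕜 ^ 4 +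
        RCLike.re ⟪y, conjLin A U ((RCLike.I : 𝕜) • z)⟫_𝕜 ^ 4) ∂unitaryHaar 𝕜 n := by
        refine integral_mono
          (integrable_of_continuous ((continuous_inner_conjLin A y z).norm.pow 4))
          (((hinteg _).add (hinteg _)).const_mul _) fun U => ?_
        have h := add_pow_le (sq_nonneg (RCLike.re ⟪y, conjLin A U z⟫_𝕜))
          (sq_nonneg (RCLike.im ⟪y, conjLin A U z⟫_𝕜)) 2
        rw [map_smul, inner_smul_right, RCLike.I_mul_re, show 4 = 2 * 2 from rfl, pow_mul,
          RCLike.norm_sq_eq_def, pow_mul, pow_mul, neg_sq, sq, sq (RCLike.im _)]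
        simpa [← sq] using h
    _ ≤ 2 * (768 * ‖A‖ ^ 4 / n ^ 2 + 768 * ‖A‖ ^ 4 / n ^ 2) := by
        rw [integral_const_mul, integral_add (hinteg _) (hinteg _)]
        gcongr
    _ = 3072 * ‖A‖ ^ 4 / n ^ 2 := by ring

theorem integral_compressionEnergy_sq_le (hA : A.IsHermitian) (htr : A.trace = 0)
    {P : Matrix (Fin n) (Fin n) 𝕜} {v : Fin r → EuclideanSpace 𝕜 (Fin n)} {θ : Fin r → ℝ}
    (hv : Orthonormal 𝕜 v) (hP : Matrix.toEuclideanLin P = frameOp v θ) :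
    ∫ U, compressionEnergy P (conjStarAlgAut 𝕜 _ U A) ^ 2 ∂unitaryHaar 𝕜 n ≤
      r ^ 2 * (∑ k, ∑ l, (θ k ^ 2 * θ l ^ 2) ^ 2) * (3072 * ‖A‖ ^ 4 / n ^ 2) := by
  set m := fun (p : Fin r × Fin r) U => ‖⟪v p.1, conjLin A U (v p.2)⟫_𝕜‖
  have henergy : ∀ U, compressionEnergy P (conjStarAlgAut 𝕜 _ U A) =
      ∑ p : Fin r × Fin r, θ p.1 ^ 2 * θ p.2 ^ 2 * m p U ^ 2 := fun U => by
    rw [compressionEnergy_eq_sum hv hP (isHermitian_conjStarAlgAut hA U), Fintype.sum_prod_type]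
    rfl
  have hm : ∀ p, Continuous (m p) := fun p => (continuous_inner_conjLin A _ _).norm
  have hinteg : ∀ p : Fin r × Fin r, Integrable (fun U => (θ p.1 ^ 2 * θ p.2 ^ 2) ^ 2 * m p U ^ 4)
      (unitaryHaar 𝕜 n) := fun p => integrable_of_continuous (((hm p).pow 4).const_mul _)
  simp only [henergy]
  calc _ ≤ ∫ U, (r ^ 2 : ℝ) * ∑ p : Fin r × Fin r, (θ p.1 ^ 2 * θ p.2 ^ 2) ^ 2 * m p U ^ 4
          ∂unitaryHaar 𝕜 n := by
        refine integral_mono (integrable_of_continuous (by fun_prop))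
          ((integrable_finsetSum _ fun p _ => hinteg p).const_mul _) fun U => ?_
        refine sq_sum_le_card_mul_sum_sq.trans_eq ?_
        rw [Finset.card_univ, Fintype.card_prod, Fintype.card_fin, Nat.cast_mul, ← sq]
        exact congrArg _ (Finset.sum_congr rfl fun p _ => by ring)
    _ = r ^ 2 * ∑ p : Fin r × Fin r, (θ p.1 ^ 2 * θ p.2 ^ 2) ^ 2 *
          ∫ U, m p U ^ 4 ∂unitaryHaar 𝕜 n := by
        rw [integral_const_mul, integral_finsetSum _ fun p _ => hinteg p]
        simp only [integral_const_mul]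
    _ ≤ r ^ 2 * ∑ p : Fin r × Fin r, (θ p.1 ^ 2 * θ p.2 ^ 2) ^ 2 *
          (3072 * ‖A‖ ^ 4 / n ^ 2) := by
        gcongr with p
        exact integral_norm_inner_conjLin_pow_four_le hA htr (hv.1 _).le (hv.1 _).le
    _ = _ := by rw [← Finset.sum_mul, Fintype.sum_prod_type, mul_assoc]

end HaarMoments

section Invariance

variable {𝕜 : Type*} [RCLike 𝕜] {n r : ℕ}

/-- The projection `A - (tr A / n) I` of `A` onto the traceless matrices. -/
def tracelessPart (A : Matrix (Fin n) (Fin n) 𝕜) : Matrix (Fin n) (Fin n) 𝕜 :=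
  A - ((n : 𝕜)⁻¹ * A.trace) • 1

theorem trace_tracelessPart (A : Matrix (Fin n) (Fin n) 𝕜) : (tracelessPart A).trace = 0 := by
  obtain rfl | hn := eq_or_ne n 0
  · exact Matrix.trace_fin_zero _
  · have hn' : (n : 𝕜) ≠ 0 := Nat.cast_ne_zero.2 hn
    rw [tracelessPart, Matrix.trace_sub, Matrix.trace_smul, Matrix.trace_one, Fintype.card_fin,
      smul_eq_mul, mul_right_comm, inv_mul_cancel₀ hn', one_mul, sub_self]

theorem isHermitian_tracelessPart {A : Matrix (Fin n) (Fin n) 𝕜} (hA : A.IsHermitian) :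
    (tracelessPart A).IsHermitian := by
  have htr : star A.trace = A.trace := by rw [← Matrix.trace_conjTranspose, hA.eq]
  refine hA.sub ?_
  rw [Matrix.IsHermitian, Matrix.conjTranspose_smul, Matrix.conjTranspose_one, star_mul', star_inv₀,
    star_natCast, htr]

theorem tracelessPart_conjStarAlgAut (U : Matrix.unitaryGroup (Fin n) 𝕜)
    (A : Matrix (Fin n) (Fin n) 𝕜) :
    tracelessPart (conjStarAlgAut 𝕜 _ U A) = conjStarAlgAut 𝕜 _ U (tracelessPart A) := by
  rw [tracelessPart, tracelessPart, trace_conjStarAlgAut, map_sub, map_smul, map_one]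

/-- A bounded version of the compression energy, so that its moments can be estimated without
truncating `A`. -/
def normalizedEnergy (P A : Matrix (Fin n) (Fin n) 𝕜) : ℝ :=
  compressionEnergy P A / (1 + ‖A‖ ^ 2)

theorem normalizedEnergy_conjStarAlgAut (U : Matrix.unitaryGroup (Fin n) 𝕜)
    (P A : Matrix (Fin n) (Fin n) 𝕜) :
    normalizedEnergy (conjStarAlgAut 𝕜 _ U P) (conjStarAlgAut 𝕜 _ U A) = normalizedEnergy P A := by
  simp only [normalizedEnergy, compressionEnergy, ← map_mul, trace_conjStarAlgAut,
    norm_conjStarAlgAut]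

theorem continuous_normalizedEnergy :
    Continuous fun q : Matrix (Fin n) (Fin n) 𝕜 × Matrix (Fin n) (Fin n) 𝕜 =>
      normalizedEnergy q.1 q.2 := by
  have hpos : ∀ A : Matrix (Fin n) (Fin n) 𝕜, 1 + ‖A‖ ^ 2 ≠ 0 := fun A => by positivity
  unfold normalizedEnergy compressionEnergy
  exact Continuous.div (by fun_prop) (by fun_prop) fun q => hpos _

theorem continuous_normalizedEnergy_tracelessPart_pow (k : ℕ) :
    Continuous fun q : Matrix (Fin n) (Fin n) 𝕜 × Matrix (Fin n) (Fin n) 𝕜 =>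
      normalizedEnergy q.2 (tracelessPart (q.1 ^ k)) := by
  have hpair : Continuous fun q : Matrix (Fin n) (Fin n) 𝕜 × Matrix (Fin n) (Fin n) 𝕜 =>
      (q.2, tracelessPart (q.1 ^ k)) := by
    unfold tracelessPart
    fun_prop
  exact (continuous_normalizedEnergy.comp hpair :)

theorem integral_normalizedEnergy_sq_le {A P : Matrix (Fin n) (Fin n) 𝕜} (hA : A.IsHermitian)
    (htr : A.trace = 0) {v : Fin r → EuclideanSpace 𝕜 (Fin n)} {θ : Fin r → ℝ}
    (hv : Orthonormal 𝕜 v) (hP : Matrix.toEuclideanLin P = frameOp v θ) :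
    ∫ U, normalizedEnergy P (conjStarAlgAut 𝕜 _ U A) ^ 2 ∂unitaryHaar 𝕜 n ≤
      3072 * r ^ 2 * (∑ k, ∑ l, (θ k ^ 2 * θ l ^ 2) ^ 2) * (1 / n ^ 2) := by
  have hnorm : ‖A‖ ^ 4 ≤ (1 + ‖A‖ ^ 2) ^ 2 := by nlinarith [sq_nonneg ‖A‖]
  simp only [normalizedEnergy, norm_conjStarAlgAut, div_pow, integral_div]
  rw [div_le_iff₀ (by positivity)]
  calc _ ≤ r ^ 2 * (∑ k, ∑ l, (θ k ^ 2 * θ l ^ 2) ^ 2) * (3072 * ‖A‖ ^ 4 / n ^ 2) :=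
        integral_compressionEnergy_sq_le hA htr hv hP
    _ ≤ r ^ 2 * (∑ k, ∑ l, (θ k ^ 2 * θ l ^ 2) ^ 2) * (3072 * (1 + ‖A‖ ^ 2) ^ 2 / n ^ 2) := by
        gcongr
    _ = _ := by ring

variable {Ω : Type*} [MeasurableSpace Ω] {Pr : Measure Ω} [IsProbabilityMeasure Pr]
  {X P : Ω → Matrix (Fin n) (Fin n) 𝕜}

theorem measurable_conjStarAlgAut :
    Measurable fun q : Matrix.unitaryGroup (Fin n) 𝕜 × Matrix (Fin n) (Fin n) 𝕜 =>
      conjStarAlgAut 𝕜 _ q.1 q.2 := by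
  simp only [Unitary.conjStarAlgAut_apply]
  exact Continuous.measurable (by fun_prop)

theorem ConjInvariant.lintegral_conj_left (hinv : ConjInvariant Pr X) (hX : Measurable X)
    (hP : Measurable P) (hind : IndepFun X P Pr)
    {F : Matrix (Fin n) (Fin n) 𝕜 × Matrix (Fin n) (Fin n) 𝕜 → ℝ≥0∞} (hF : Measurable F)
    (U : Matrix.unitaryGroup (Fin n) 𝕜) :
    ∫⁻ ω, F (conjStarAlgAut 𝕜 _ U (X ω), P ω) ∂Pr = ∫⁻ ω, F (X ω, P ω) ∂Pr := by
  have hU : Measurable fun A : Matrix (Fin n) (Fin n) 𝕜 => conjStarAlgAut 𝕜 _ U A := by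
    simp only [Unitary.conjStarAlgAut_apply]
    exact Continuous.measurable (by fun_prop)
  have hX' : Measurable fun ω => conjStarAlgAut 𝕜 _ U (X ω) := hU.comp hX
  have hlaw : Measure.map (fun ω => conjStarAlgAut 𝕜 _ U (X ω)) Pr = Measure.map X Pr := by
    simpa only [Unitary.conjStarAlgAut_apply] using hinv U U.2
  have hjoint := (indepFun_iff_map_prod_eq_prod_map_map hX'.aemeasurable hP.aemeasurable).1
    (hind.comp hU measurable_id)
  rw [hlaw, ← (indepFun_iff_map_prod_eq_prod_map_map hX.aemeasurable hP.aemeasurable).1 hind]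
    at hjoint
  rw [← lintegral_map hF (hX'.prodMk hP), hjoint, lintegral_map hF (hX.prodMk hP)]

theorem lintegral_conj_left (hinv : ConjInvariant Pr X ∨ ConjInvariant Pr P) (hX : Measurable X)
    (hP : Measurable P) (hind : IndepFun X P Pr)
    {F : Matrix (Fin n) (Fin n) 𝕜 × Matrix (Fin n) (Fin n) 𝕜 → ℝ≥0∞} (hF : Measurable F)
    (hFinv : ∀ U A B, F (conjStarAlgAut 𝕜 _ U A, conjStarAlgAut 𝕜 _ U B) = F (A, B))
    (U : Matrix.unitaryGroup (Fin n) 𝕜) :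
    ∫⁻ ω, F (conjStarAlgAut 𝕜 _ U (X ω), P ω) ∂Pr = ∫⁻ ω, F (X ω, P ω) ∂Pr := by
  obtain hinv | hinv := hinv
  · exact hinv.lintegral_conj_left hX hP hind hF U
  · have hinverse := hinv.lintegral_conj_left hP hX hind.symm (hF.comp measurable_swap) U⁻¹
    simp only [Function.comp_apply, Prod.swap_prod_mk] at hinverse
    rw [← hinverse]
    refine lintegral_congr fun ω => ?_
    rw [← hFinv U (X ω), ← Unitary.conjStarAlgAut_mul_apply, mul_inv_cancel, map_one]
    rfl

theorem lintegral_eq_lintegral_unitaryHaar (hinv : ConjInvariant Pr X ∨ ConjInvariant Pr P)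
    (hX : Measurable X) (hP : Measurable P) (hind : IndepFun X P Pr)
    {F : Matrix (Fin n) (Fin n) 𝕜 × Matrix (Fin n) (Fin n) 𝕜 → ℝ≥0∞} (hF : Measurable F)
    (hFinv : ∀ U A B, F (conjStarAlgAut 𝕜 _ U A, conjStarAlgAut 𝕜 _ U B) = F (A, B)) :
    ∫⁻ ω, F (X ω, P ω) ∂Pr =
      ∫⁻ ω, ∫⁻ U, F (conjStarAlgAut 𝕜 _ U (X ω), P ω) ∂unitaryHaar 𝕜 n ∂Pr := by
  have hjoint : Measurable fun q : Ω × Matrix.unitaryGroup (Fin n) 𝕜 =>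
      F (conjStarAlgAut 𝕜 _ q.2 (X q.1), P q.1) :=
    hF.comp ((measurable_conjStarAlgAut.comp
      (measurable_snd.prodMk (hX.comp measurable_fst))).prodMk (hP.comp measurable_fst))
  rw [lintegral_lintegral_swap hjoint.aemeasurable]
  simp only [lintegral_conj_left hinv hX hP hind hF hFinv, lintegral_const, measure_univ, mul_one]

theorem lintegral_normalizedEnergy_sq_le (hinv : ConjInvariant Pr X ∨ ConjInvariant Pr P)
    (hX : Measurable X) (hP : Measurable P) (hind : IndepFun X P Pr)
    (hXh : ∀ ω, (X ω).IsHermitian) {v : Ω → Fin r → EuclideanSpace 𝕜 (Fin n)} {θ : Fin r → ℝ}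
    (hv : ∀ ω, Orthonormal 𝕜 (v ω)) (hPv : ∀ ω, Matrix.toEuclideanLin (P ω) = frameOp (v ω) θ)
    (k : ℕ) :
    ∫⁻ ω, .ofReal (normalizedEnergy (P ω) (tracelessPart (X ω ^ k)) ^ 2) ∂Pr ≤
      .ofReal (3072 * r ^ 2 * (∑ k, ∑ l, (θ k ^ 2 * θ l ^ 2) ^ 2) * (1 / n ^ 2)) := by
  let F := fun q : Matrix (Fin n) (Fin n) 𝕜 × Matrix (Fin n) (Fin n) 𝕜 =>
    ENNReal.ofReal (normalizedEnergy q.2 (tracelessPart (q.1 ^ k)) ^ 2)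
  have hF : Measurable F :=
    ((continuous_normalizedEnergy_tracelessPart_pow k).pow 2).measurable.ennreal_ofReal
  have hconj : ∀ U (A : Matrix (Fin n) (Fin n) 𝕜), tracelessPart (conjStarAlgAut 𝕜 _ U A ^ k) =
      conjStarAlgAut 𝕜 _ U (tracelessPart (A ^ k)) := fun U A => by
    rw [← map_pow, tracelessPart_conjStarAlgAut]
  have hFinv : ∀ U A B, F (conjStarAlgAut 𝕜 _ U A, conjStarAlgAut 𝕜 _ U B) = F (A, B) :=
    fun U A B => by simp only [F, hconj, normalizedEnergy_conjStarAlgAut]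
  calc _ = ∫⁻ ω, ∫⁻ U, F (conjStarAlgAut 𝕜 _ U (X ω), P ω) ∂unitaryHaar 𝕜 n ∂Pr :=
        lintegral_eq_lintegral_unitaryHaar hinv hX hP hind hF hFinv
    _ ≤ ∫⁻ _, _ ∂Pr := lintegral_mono fun ω => ?_
    _ = _ := by rw [lintegral_const, measure_univ, mul_one]
  have hcont : Continuous fun U =>
      normalizedEnergy (P ω) (conjStarAlgAut 𝕜 _ U (tracelessPart (X ω ^ k))) ^ 2 :=
    (continuous_normalizedEnergy.comp
      (continuous_const.prodMk (continuous_conjStarAlgAut _))).pow 2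
  simp only [F, hconj]
  rw [← ofReal_integral_eq_lintegral_ofReal (integrable_of_continuous hcont)
    (.of_forall fun U => sq_nonneg _)]
  exact ENNReal.ofReal_le_ofReal (integral_normalizedEnergy_sq_le
    (isHermitian_tracelessPart ((hXh ω).pow k)) (trace_tracelessPart _) (hv ω) (hPv ω))

end Invariance

section AlmostSureLimit

theorem ae_tendsto_zero_of_lintegral_le_summable {Ω : Type*} [MeasurableSpace Ω] {Pr : Measure Ω}
    {F : ℕ → Ω → ℝ≥0∞} (hF : ∀ n, AEMeasurable (F n) Pr) {g : ℕ → ℝ} (hg : Summable g)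
    (h : ∀ᶠ n in atTop, ∫⁻ ω, F n ω ∂Pr ≤ .ofReal (g n)) :
    ∀ᵐ ω ∂Pr, Tendsto (fun n => F n ω) atTop (𝓝 0) := by
  obtain ⟨N, hN⟩ := eventually_atTop.1 h
  have hsum : ∫⁻ ω, ∑' n, F (n + N) ω ∂Pr ≠ ∞ := by
    rw [lintegral_tsum fun n => hF _]
    exact ne_top_of_le_ne_top ((summable_nat_add_iff N).2 hg).tsum_ofReal_ne_top
      (ENNReal.tsum_le_tsum fun n => hN (n + N) (Nat.le_add_left _ _))
  filter_upwards [ae_lt_top' (.tsum fun n => hF (n + N)) hsum] with ω hω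
  exact (tendsto_add_atTop_iff_nat N).1 (ENNReal.tendsto_atTop_zero_of_tsum_ne_top hω.ne)

theorem tendsto_zero_of_tendsto_sq {α : Type*} {L : Filter α} {g : α → ℝ}
    (h : Tendsto (fun a => g a ^ 2) L (𝓝 0)) : Tendsto g L (𝓝 0) := by
  have hsqrt := h.sqrt
  simp only [Real.sqrt_sq_eq_abs, Real.sqrt_zero] at hsqrt
  exact (tendsto_zero_iff_abs_tendsto_zero g).2 hsqrt

variable {𝕜 : Type*} [RCLike 𝕜] {r : ℕ}

section Matrix

variable {n : ℕ}

theorem orderedEigenvalue_nonneg {A : Matrix (Fin n) (Fin n) 𝕜} (hA : A.PosSemidef) (i : Fin n) :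
    0 ≤ orderedEigenvalue A i := by
  obtain ⟨σ, hσ⟩ := exists_equiv_eigenvalues_eq hA.1
  simpa only [hσ, Equiv.apply_symm_apply] using hA.eigenvalues_nonneg (σ.symm i)

theorem integral_empiricalMeasure (A : Matrix (Fin n) (Fin n) 𝕜) (f : ℝ → ℝ) :
    ∫ t, f t ∂empiricalMeasure A = (n : ℝ)⁻¹ * ∑ i : Fin n, f (orderedEigenvalue A i) := by
  rw [empiricalMeasure, integral_smul_measure,
    integral_finsetSum_measure fun i _ => integrable_dirac enorm_lt_top]
  simp

section Frame

variable {A : Matrix (Fin n) (Fin n) 𝕜} {e : OrthonormalBasis (Fin n) 𝕜 (EuclideanSpace 𝕜 (Fin n))}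
  {x : Fin n → ℝ} (hA : Matrix.toEuclideanLin A = frameOp e x)
include hA

theorem toEuclideanLin_pow (k : ℕ) : Matrix.toEuclideanLin (A ^ k) = frameOp e (x ^ k) := by
  induction k with
  | zero => rw [pow_zero, pow_zero, toEuclideanLin_one, frameOp_one]
  | succ k ih =>
    ext1 y
    rw [pow_succ, toEuclideanLin_mul_apply, ih, hA, frameOp_frameOp e.orthonormal, pow_succ]

theorem trace_eq_sum_of_eq_frameOp : A.trace = ((∑ i, x i : ℝ) : 𝕜) := by
  rw [← sum_inner_toEuclideanLin A e, hA, RCLike.ofReal_sum]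
  refine Finset.sum_congr rfl fun i _ => ?_
  rw [inner_left_frameOp e.orthonormal, inner_self_eq_norm_sq_to_K, e.norm_eq_one]
  simp

theorem norm_le_of_eq_frameOp {K : ℝ} (hK : 0 ≤ K) (hx : ∀ i, |x i| ≤ K) : ‖A‖ ≤ K :=
  ContinuousLinearMap.opNorm_le_bound _ hK fun y => by
    have := norm_frameOp_le (𝕜 := 𝕜) e.orthonormal hK hx y
    rw [← hA] at this
    exact this

end Frame

theorem norm_tracelessPart_le (A : Matrix (Fin n) (Fin n) 𝕜) :
    ‖tracelessPart A‖ ≤ ‖A‖ + ‖(n : 𝕜)⁻¹ * A.trace‖ := by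
  have hone : ‖(1 : Matrix (Fin n) (Fin n) 𝕜)‖ ≤ 1 :=
    norm_le_of_eq_frameOp (toEuclideanLin_one.trans
      (frameOp_one (EuclideanSpace.basisFun (Fin n) 𝕜)).symm) zero_le_one (by simp)
  refine (norm_sub_le _ _).trans (add_le_add_right ?_ _)
  rw [norm_smul]
  exact mul_le_of_le_one_right (norm_nonneg _) hone

theorem inner_toEuclideanLin_eq_add {κ : Type*} [DecidableEq κ]
    {v : κ → EuclideanSpace 𝕜 (Fin n)} (hv : Orthonormal 𝕜 v) (A : Matrix (Fin n) (Fin n) 𝕜)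
    (k l : κ) :
    ⟪v k, Matrix.toEuclideanLin A (v l)⟫_𝕜 =
      ⟪v k, Matrix.toEuclideanLin (tracelessPart A) (v l)⟫_𝕜 +
        if k = l then (n : 𝕜)⁻¹ * A.trace else 0 := by
  rw [tracelessPart, map_sub, map_smul, toEuclideanLin_one, LinearMap.sub_apply,
    LinearMap.smul_apply, LinearMap.id_apply, inner_sub_right, inner_smul_right,
    orthonormal_iff_ite.1 hv, mul_ite, mul_one, mul_zero, sub_add_cancel]

theorem mul_norm_inner_sq_le_compressionEnergy {A P : Matrix (Fin n) (Fin n) 𝕜}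
    {v : Fin r → EuclideanSpace 𝕜 (Fin n)} {θ : Fin r → ℝ} (hv : Orthonormal 𝕜 v)
    (hP : Matrix.toEuclideanLin P = frameOp v θ) (hA : A.IsHermitian) (k l : Fin r) :
    θ k ^ 2 * θ l ^ 2 * ‖⟪v k, Matrix.toEuclideanLin A (v l)⟫_𝕜‖ ^ 2 ≤ compressionEnergy P A := by
  let f := fun k l => θ k ^ 2 * θ l ^ 2 * ‖⟪v k, Matrix.toEuclideanLin A (v l)⟫_𝕜‖ ^ 2
  have hf : ∀ k l, 0 ≤ f k l := fun k l => by positivity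
  calc f k l ≤ ∑ l, f k l :=
        Finset.single_le_sum (fun l _ => hf k l) (Finset.mem_univ l)
    _ ≤ ∑ k, ∑ l, f k l := Finset.single_le_sum (f := fun k => ∑ l, f k l)
        (fun k _ => Finset.sum_nonneg fun l _ => hf k l) (Finset.mem_univ k)
    _ = compressionEnergy P A := (compressionEnergy_eq_sum hv hP hA).symm

end Matrix

variable {X P : ∀ n, Matrix (Fin n) (Fin n) 𝕜} {v : ∀ n, Fin r → EuclideanSpace 𝕜 (Fin n)}
  {θ : Fin r → ℝ}

theorem tendsto_inner_of_tendsto_normalizedEnergy (hv : ∀ n, r ≤ n → Orthonormal 𝕜 (v n))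
    (hP : ∀ n, r ≤ n → Matrix.toEuclideanLin (P n) = frameOp (v n) θ) (hθ : ∀ i, θ i ≠ 0)
    (hX : ∀ n, (X n).IsHermitian) {K : ℝ} (hK : ∀ᶠ n in atTop, ‖X n‖ ≤ K)
    (hE : Tendsto (fun n => normalizedEnergy (P n) (X n)) atTop (𝓝 0)) (k l : Fin r) :
    Tendsto (fun n => ⟪v n k, Matrix.toEuclideanLin (X n) (v n l)⟫_𝕜) atTop (𝓝 0) := by
  have hpos : 0 < θ k ^ 2 * θ l ^ 2 := mul_pos (sq_pos_of_ne_zero (hθ k)) (sq_pos_of_ne_zero (hθ l))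
  have hbound := (hE.mul_const (1 + K ^ 2)).div_const (θ k ^ 2 * θ l ^ 2)
  rw [zero_mul, zero_div] at hbound
  refine tendsto_zero_iff_norm_tendsto_zero.2 (tendsto_zero_of_tendsto_sq
    (squeeze_zero' (.of_forall fun n => sq_nonneg _) ?_ hbound))
  filter_upwards [hK, eventually_ge_atTop r] with n hn hr
  rw [le_div_iff₀' hpos]
  calc _ ≤ compressionEnergy (P n) (X n) :=
        mul_norm_inner_sq_le_compressionEnergy (hv n hr) (hP n hr) (hX n) k l
    _ = normalizedEnergy (P n) (X n) * (1 + ‖X n‖ ^ 2) :=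
        (div_mul_cancel₀ _ (by positivity)).symm
    _ ≤ normalizedEnergy (P n) (X n) * (1 + K ^ 2) := by
        have hE₀ : 0 ≤ compressionEnergy (P n) (X n) := le_trans (by positivity)
          (mul_norm_inner_sq_le_compressionEnergy (hv n hr) (hP n hr) (hX n) k l)
        have : 0 ≤ normalizedEnergy (P n) (X n) := div_nonneg hE₀ (by positivity)
        gcongr

theorem tendsto_inner_of_tendsto_normalizedEnergy_tracelessPart
    (hv : ∀ n, r ≤ n → Orthonormal 𝕜 (v n))
    (hP : ∀ n, r ≤ n → Matrix.toEuclideanLin (P n) = frameOp (v n) θ) (hθ : ∀ i, θ i ≠ 0)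
    (hX : ∀ n, (X n).IsHermitian) {K : ℝ} (hK : ∀ᶠ n in atTop, ‖X n‖ ≤ K) {c : 𝕜}
    (hc : Tendsto (fun n : ℕ => (n : 𝕜)⁻¹ * (X n).trace) atTop (𝓝 c))
    (hE : Tendsto (fun n => normalizedEnergy (P n) (tracelessPart (X n))) atTop (𝓝 0))
    (k l : Fin r) :
    Tendsto (fun n => ⟪v n k, Matrix.toEuclideanLin (X n) (v n l)⟫_𝕜) atTop
      (𝓝 (if k = l then c else 0)) := by
  have hK' : ∀ᶠ n in atTop, ‖tracelessPart (X n)‖ ≤ K + (‖c‖ + 1) := by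
    filter_upwards [hK, hc.norm.eventually_le_const (lt_add_one ‖c‖)] with n hn hcn
    exact (norm_tracelessPart_le _).trans (add_le_add hn hcn)
  have hzero := tendsto_inner_of_tendsto_normalizedEnergy hv hP hθ
    (fun n => isHermitian_tracelessPart (hX n)) hK' hE k l
  have hδ : Tendsto (fun n : ℕ => if k = l then (n : 𝕜)⁻¹ * (X n).trace else 0) atTop
      (𝓝 (if k = l then c else 0)) := by
    split_ifs
    exacts [hc, tendsto_const_nhds]
  rw [← zero_add (ite _ _ _)]
  refine (hzero.add hδ).congr' ?_
  filter_upwards [eventually_ge_atTop r] with n hn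
  exact (inner_toEuclideanLin_eq_add (hv n hn) _ k l).symm

theorem nonneg_of_tendsto_orderedEigenvalue {a : ℝ} (hX : ∀ n, (X n).PosSemidef)
    (hmin : Tendsto (fun n => orderedEigenvalue (X n) (n - 1)) atTop (𝓝 a)) : 0 ≤ a :=
  ge_of_tendsto hmin ((eventually_gt_atTop 0).mono fun n hn =>
    orderedEigenvalue_nonneg (hX n) ⟨n - 1, Nat.sub_one_lt hn.ne'⟩)

theorem eventually_orderedEigenvalue_mem {a b : ℝ} (hX : ∀ n, (X n).IsHermitian)
    (hmax : Tendsto (fun n => orderedEigenvalue (X n) 0) atTop (𝓝 b))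
    (hmin : Tendsto (fun n => orderedEigenvalue (X n) (n - 1)) atTop (𝓝 a)) {U : Set ℝ}
    (hab : a ≤ b) (hU : U ∈ 𝓝ˢ (Set.Icc a b)) :
    ∀ᶠ n in atTop, ∀ i : Fin n, orderedEigenvalue (X n) i ∈ U := by
  rw [mem_nhdsSet_iff_forall] at hU
  obtain ⟨c, hc, hcU⟩ := exists_Ioc_subset_of_mem_nhds (hU a ⟨le_rfl, hab⟩) (exists_lt a)
  obtain ⟨d, hd, hdU⟩ := exists_Ico_subset_of_mem_nhds (hU b ⟨hab, le_rfl⟩) (exists_gt b)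
  filter_upwards [hmax.eventually_lt_const hd, hmin.eventually_const_lt hc] with n hn hn' i
  have hfirst := orderedEigenvalue_antitone (hX n)
    (show (⟨0, i.pos⟩ : Fin n) ≤ i from Nat.zero_le _)
  have hlast := orderedEigenvalue_antitone (hX n)
    (show i ≤ (⟨n - 1, Nat.sub_one_lt i.pos.ne'⟩ : Fin n) from Nat.le_sub_one_of_lt i.2)
  rcases le_or_gt (orderedEigenvalue (X n) i) a with hi | hi
  · exact hcU ⟨hn'.trans_le hlast, hi⟩
  · rcases le_or_gt b (orderedEigenvalue (X n) i) with hi' | hi'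
    · exact hdU ⟨hi', hfirst.trans_lt hn⟩
    · exact mem_of_mem_nhds (hU _ ⟨hi.le, hi'.le⟩)

theorem WeaklyConverges.tendsto_average_eigenvalues {μ : Measure ℝ}
    (h : WeaklyConverges (fun n => empiricalMeasure (X n)) μ) {c d : ℝ} (hcd : c ≤ d)
    (hμ : ∀ᵐ t ∂μ, t ∈ Set.Icc c d)
    (hX : ∀ᶠ n in atTop, ∀ i : Fin n, orderedEigenvalue (X n) i ∈ Set.Icc c d) {f : ℝ → ℝ}
    (hf : ContinuousOn f (Set.Icc c d)) :
    Tendsto (fun n : ℕ => (n : ℝ)⁻¹ * ∑ i : Fin n, f (orderedEigenvalue (X n) i)) atTop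
      (𝓝 (∫ t, f t ∂μ)) := by
  let g : ℝ →ᵇ ℝ := (BoundedContinuousFunction.mkOfCompact ⟨_, hf.domRestrict⟩).compContinuous
    ⟨Set.projIcc c d hcd, continuous_projIcc⟩
  have hg : ∀ t ∈ Set.Icc c d, g t = f t := fun t ht => by
    simp [g, Set.projIcc_of_mem hcd ht]
  have hlim := h g
  simp only [integral_empiricalMeasure] at hlim
  rw [← integral_congr_ae (hμ.mono hg)]
  refine hlim.congr' (hX.mono fun n hn => ?_)
  simp only [fun i => hg _ (hn i)]

variable {μ : Measure ℝ} [IsProbabilityMeasure μ] {a b : ℝ}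
  {e : ∀ n, OrthonormalBasis (Fin n) 𝕜 (EuclideanSpace 𝕜 (Fin n))}

theorem isotropicLimit_of_tendsto_normalizedEnergy (hX : ∀ n, (X n).IsHermitian)
    (he : ∀ n, Matrix.toEuclideanLin (X n) = frameOp (e n) fun i => orderedEigenvalue (X n) i)
    (hv : ∀ n, r ≤ n → Orthonormal 𝕜 (v n))
    (hP : ∀ n, r ≤ n → Matrix.toEuclideanLin (P n) = frameOp (v n) θ) (hθ : ∀ i, θ i ≠ 0)
    (hμ : ∀ᵐ t ∂μ, t ∈ Set.Icc a b)
    (hlim : WeaklyConverges (fun n => empiricalMeasure (X n)) μ)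
    (hmax : Tendsto (fun n => orderedEigenvalue (X n) 0) atTop (𝓝 b))
    (hmin : Tendsto (fun n => orderedEigenvalue (X n) (n - 1)) atTop (𝓝 a))
    (hE : ∀ k, Tendsto (fun n => normalizedEnergy (P n) (tracelessPart (X n ^ k))) atTop (𝓝 0)) :
    IsotropicLimit μ a b e (fun n i => orderedEigenvalue (X n) i) v := by
  obtain ⟨t, hat, htb⟩ := hμ.exists
  have hmem := fun U => eventually_orderedEigenvalue_mem (U := U) hX hmax hmin (hat.trans htb)
  have hsub : Set.Icc a b ⊆ Set.Ioo (a - 1) (b + 1) :=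
    Set.Icc_subset_Ioo (sub_one_lt a) (lt_add_one b)
  have hIcc := hmem _ (mem_of_superset (isOpen_Ioo.mem_nhdsSet.2 hsub) Set.Ioo_subset_Icc_self)
  refine ⟨eventually_atTop.2 ⟨r, hv⟩, hmem, fun m k l => ?_⟩
  have hpow : ∀ n, Matrix.toEuclideanLin (X n ^ m) =
      frameOp (e n) ((fun i : Fin n => orderedEigenvalue (X n) i) ^ m) :=
    fun n => toEuclideanLin_pow (he n) m
  obtain ⟨K, hK⟩ := isCompact_Icc.exists_bound_of_continuousOn
    (s := Set.Icc (a - 1) (b + 1)) (f := fun t : ℝ => t ^ m) (by fun_prop)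
  have hnorm : ∀ᶠ n in atTop, ‖X n ^ m‖ ≤ max K 0 := hIcc.mono fun n hn =>
    norm_le_of_eq_frameOp (hpow n) (le_max_right K 0)
      fun i => (hK _ (hn i)).trans (le_max_left K 0)
  have htr : Tendsto (fun n : ℕ => (n : 𝕜)⁻¹ * (X n ^ m).trace) atTop
      (𝓝 ((∫ t, t ^ m ∂μ : ℝ) : 𝕜)) := by
    have hmean := hlim.tendsto_average_eigenvalues (by linarith)
      (hμ.mono fun t ht => Set.Ioo_subset_Icc_self (hsub ht)) hIcc (f := fun t => t ^ m)
      (by fun_prop)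
    refine ((RCLike.continuous_ofReal (K := 𝕜)).continuousAt.tendsto.comp hmean).congr fun n => ?_
    rw [trace_eq_sum_of_eq_frameOp (hpow n), Function.comp_apply, RCLike.ofReal_mul,
      RCLike.ofReal_inv, RCLike.ofReal_natCast]
    rfl
  simpa only [hpow] using tendsto_inner_of_tendsto_normalizedEnergy_tracelessPart hv hP hθ
    (fun n => (hX n).pow m) hnorm htr (hE m) k l

section Random

variable {Ω : Type*} [MeasurableSpace Ω] {Pr : Measure Ω} [IsProbabilityMeasure Pr]
  {X P : ∀ n : ℕ, Ω → Matrix (Fin n) (Fin n) 𝕜} (hX : ∀ n, Measurable (X n))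
  (hP : ∀ n, Measurable (P n)) (hind : ∀ n, r ≤ n → IndepFun (X n) (P n) Pr)
  (hinv : ∀ n, r ≤ n → ConjInvariant Pr (X n) ∨ ConjInvariant Pr (P n))
  (hXh : ∀ n ω, (X n ω).IsHermitian) {v : ∀ n, Ω → Fin r → EuclideanSpace 𝕜 (Fin n)}
  (hv : ∀ n ω, r ≤ n → Orthonormal 𝕜 (v n ω))
  (hPv : ∀ n ω, r ≤ n → Matrix.toEuclideanLin (P n ω) = frameOp (v n ω) θ)
include hX hP hind hinv hXh hv hPv

theorem ae_tendsto_normalizedEnergy : ∀ᵐ ω ∂Pr, ∀ k : ℕ,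
    Tendsto (fun n => normalizedEnergy (P n ω) (tracelessPart (X n ω ^ k))) atTop (𝓝 0) := by
  refine ae_all_iff.2 fun k => ?_
  have hmeas : ∀ n, AEMeasurable
      (fun ω => ENNReal.ofReal (normalizedEnergy (P n ω) (tracelessPart (X n ω ^ k)) ^ 2)) Pr :=
    fun n => (((continuous_normalizedEnergy_tracelessPart_pow k).pow 2).measurable.ennreal_ofReal
      |>.comp ((hX n).prodMk (hP n))).aemeasurable
  have hsum := (Real.summable_one_div_nat_pow.2 one_lt_two).mul_left
    (3072 * r ^ 2 * ∑ k, ∑ l, (θ k ^ 2 * θ l ^ 2) ^ 2)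
  have hBC := ae_tendsto_zero_of_lintegral_le_summable hmeas hsum <|
    (eventually_ge_atTop r).mono fun n hn => lintegral_normalizedEnergy_sq_le (hinv n hn) (hX n)
      (hP n) (hind n hn) (hXh n) (hv n · hn) (hPv n · hn) k
  refine hBC.mono fun ω hω => tendsto_zero_of_tendsto_sq ?_
  simpa only [Function.comp_def, ENNReal.toReal_ofReal (sq_nonneg _), ENNReal.toReal_zero] using
    (ENNReal.tendsto_toReal ENNReal.zero_ne_top).comp hω

theorem ae_isotropicLimit {e : ∀ n, Ω → OrthonormalBasis (Fin n) 𝕜 (EuclideanSpace 𝕜 (Fin n))}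
    (he : ∀ n ω, Matrix.toEuclideanLin (X n ω) =
      frameOp (e n ω) fun i => orderedEigenvalue (X n ω) i) (hθ : ∀ i, θ i ≠ 0)
    (hμ : ∀ᵐ t ∂μ, t ∈ Set.Icc a b)
    (hlim : ∀ᵐ ω ∂Pr, WeaklyConverges (fun n => empiricalMeasure (X n ω)) μ)
    (hmax : ∀ᵐ ω ∂Pr, Tendsto (fun n => orderedEigenvalue (X n ω) 0) atTop (𝓝 b))
    (hmin : ∀ᵐ ω ∂Pr, Tendsto (fun n => orderedEigenvalue (X n ω) (n - 1)) atTop (𝓝 a)) :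
    ∀ᵐ ω ∂Pr, IsotropicLimit μ a b (e · ω) (fun n i => orderedEigenvalue (X n ω) i) (v · ω) := by
  filter_upwards [hlim, hmax, hmin, ae_tendsto_normalizedEnergy hX hP hind hinv hXh hv hPv]
    with ω hlim hmax hmin hE
  exact isotropicLimit_of_tendsto_normalizedEnergy (hXh · ω) (he · ω) (hv · ω) (hPv · ω) hθ hμ
    hlim hmax hmin hE

end Random

end AlmostSureLimit

end SpikedModel

end

theorem theorem2p7 {𝕜 : Type*} [RCLike 𝕜]
    {Ω : Type*} [MeasurableSpace Ω] (Pr : Measure Ω) [IsProbabilityMeasure Pr]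
    -- the random matrices, the size-`n` matrices `X n` being non-negative definite
    (X P : ∀ n : ℕ, Ω → Matrix (Fin n) (Fin n) 𝕜)
    (hXm : ∀ n, Measurable (X n)) (hPm : ∀ n, Measurable (P n))
    (hXpos : ∀ n ω, (X n ω).PosSemidef)
    -- the limiting eigenvalue distribution
    (μ : Measure ℝ) [IsProbabilityMeasure μ] (hμc : IsCompact μ.support)
    (hμ0 : μ ≠ Measure.dirac 0)
    (hμ : ∀ᵐ ω ∂Pr, SpikedModel.WeaklyConverges (fun n => SpikedModel.empiricalMeasure (X n ω)) μ)
    (a b : ℝ) (ha : IsGLB μ.support a) (hb : IsLUB μ.support b)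
    (hmax : ∀ᵐ ω ∂Pr,
      Tendsto (fun n => SpikedModel.orderedEigenvalue (X n ω) 0) atTop (𝓝 b))
    (hmin : ∀ᵐ ω ∂Pr,
      Tendsto (fun n => SpikedModel.orderedEigenvalue (X n ω) (n - 1)) atTop (𝓝 a))
    -- the perturbation of rank `r`
    (r : ℕ) (θ : Fin r → ℝ) (hθ : Antitone θ) (hθ0 : ∀ i, θ i ≠ 0)
    (hP : ∀ n, r ≤ n → ∀ ω, SpikedModel.HasNonzeroSpectrum (P n ω) θ)
    -- independence and invariance
    (hindep : ∀ n, r ≤ n → IndepFun (X n) (P n) Pr)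
    (hinv : ∀ n, r ≤ n →
      SpikedModel.ConjInvariant Pr (X n) ∨ SpikedModel.ConjInvariant Pr (P n))
    -- the index of a supercritical eigenvalue of the perturbation
    (i₀ : Fin r)
    (hlow : SpikedModel.tTransformLeft μ a < ((1 / θ i₀ : ℝ) : EReal))
    (hup : ((1 / θ i₀ : ℝ) : EReal) < SpikedModel.tTransformRight μ b)
    -- the unit-norm eigenvectors
    (u : ∀ n : ℕ, Ω → EuclideanSpace 𝕜 (Fin n))
    (hu : ∀ n, r ≤ n → ∀ ω, SpikedModel.IsUnitEigenvector
      (SpikedModel.perturbed (X n ω) (P n ω))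
      (SpikedModel.outlierEigenvalue (X n ω) (P n ω) θ i₀) (u n ω)) :
    ∃ ρ : ℝ,
      -- `ρ = T_μ⁻¹ (1 / θ i₀)`
      (ρ ∉ Set.Icc a b ∧ SpikedModel.tTransform μ ρ = 1 / θ i₀ ∧
        ∀ z : ℝ, z ∉ Set.Icc a b → SpikedModel.tTransform μ z = 1 / θ i₀ → z = ρ) ∧
      DifferentiableAt ℝ (SpikedModel.tTransform μ) ρ ∧
      (∀ᵐ ω ∂Pr, Tendsto
        (fun n => SpikedModel.outlierEigenvalue (X n ω) (P n ω) θ i₀) atTop (𝓝 ρ)) ∧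
      (∀ᵐ ω ∂Pr, Tendsto
        (fun n => SpikedModel.projNorm (u n ω) (SpikedModel.kerSub (P n ω) (θ i₀)) ^ 2) atTop
        (𝓝 (-1 / (θ i₀ ^ 2 * ρ * deriv (SpikedModel.tTransform μ) ρ + θ i₀)))) ∧
      (∀ᵐ ω ∂Pr, Tendsto
        (fun n => SpikedModel.projNorm (u n ω)
          (⨆ j : {j : Fin r // θ j ≠ θ i₀}, SpikedModel.kerSub (P n ω) (θ j))) atTop
        (𝓝 0)) := by
  have hμ' := SpikedModel.ae_mem_Icc_of_support ha hb
  have ha₀ : 0 ≤ a := hmin.exists.elim fun ω =>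
    SpikedModel.nonneg_of_tendsto_orderedEigenvalue (hXpos · ω)
  have hθ₀ := one_div_ne_zero (hθ0 i₀)
  obtain ⟨ρ, hρ, hTρ⟩ := SpikedModel.exists_tTransform_eq hμ' ha₀ hμ0 hθ₀ hlow hup
  choose e he using fun n ω => SpikedModel.exists_eigenbasis (hXpos n ω).1
  have hframe := fun n ω (hn : r ≤ n) => (hP n hn ω).exists_frame
  choose! v hv hPv using hframe
  have hlim := SpikedModel.ae_isotropicLimit hXm hPm hindep hinv (hXpos · · |>.1) hv hPv he hθ0
    hμ' hμ hmax hmin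
  have hout : ∀ᵐ ω ∂Pr, Tendsto
      (fun n => SpikedModel.outlierEigenvalue (X n ω) (P n ω) θ i₀) atTop (𝓝 ρ) :=
    hlim.mono fun ω h => h.tendsto_outlier hμ' ha₀
      (fun n => SpikedModel.orderedEigenvalue_nonneg (hXpos n ω)) (he · ω) hθ (hPv · ω) hμ0 i₀
      (hθ0 i₀) hρ hTρ
  refine ⟨ρ, ⟨hρ, hTρ, fun z hz hTz => SpikedModel.eq_of_tTransform_eq hμ' ha₀ hμ0 hρ hz
    (hTρ ▸ hθ₀) (hTz.trans hTρ.symm)⟩, (SpikedModel.hasDerivAt_tTransform hμ' hρ).differentiableAt,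
    hout, ?_, ?_⟩
  · filter_upwards [hlim, hout] with ω h hl
    exact h.tendsto_projNorm_kerSub (hu · · ω) (he · ω) (hPv · ω) hρ hl hμ' (hθ0 i₀) hTρ
  · filter_upwards [hlim, hout] with ω h hl
    exact h.tendsto_projNorm_iSup_kerSub (hu · · ω) (he · ω) (hPv · ω) hρ hl hμ' (hθ0 i₀) hTρ hθ0
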